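/- Let $m,n$ be positive integers, $B_0=\{1<\overline 1<2<\overline 2<\cdots<m<\overline m\}$, $B_1=\{1^\circ<\cdots<n^\circ\}$, and order $B=B_0\cup B_1$ so that every letter of $B_0$ precedes every letter of $B_1$. An \emph{$spo$-tableau} of shape $\lambda$ is a filling of the Young diagram $\lambda$ with letters of $B$ such that (i) the boxes with entries in $B_0$ form a Young diagram on which the filling is weakly increasing along rows and strictly increasing down columns, and all its entries in row $i$ are $\ge i$ (so it has at most $m$ rows); (ii) the entries in $B_1$ strictly increase along rows and weakly increase down columns. Shapes may be empty. \emph{Insertion.} For $x\in B_0$, $T\leftarrow x$ starts by inserting $x$ into the first row; for $y\in B_1$, $y\to T$ starts by inserting $y$ into the first column. A letter inserted into a row (resp. column) replaces the leftmost (resp. topmost) entry larger than it, or is put in a new box at the end if there is none, in which case the insertion stops. A displaced letter of $B_0$ is inserted into the next row and a displaced letter of $B_1$ into the next column. Exception (\emph{cancellation}): if the letter $i$ would replace an entry $\overline i$ in row $i$, then instead this $\overline i$ is removed, and the resulting empty box is moved by slides to an outer corner, where it is deleted: if $a$ is the entry to the right of the empty box and $b$ the entry below it, then $a$ slides into the empty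 box if $a<b$ or $a=b\in B_1$, and $b$ does otherwise; if only one of them exists, that one slides. For a one-row $spo$-tableau $U$ of shape $(k)$ with entries $x_s\le\cdots\le x_1$ in $B_0$ followed by $a_1<\cdots<a_{m_1}$ in $B_1$ (so $s+m_1=k$), put $$T\cdot U=(a_1\to\cdots\to a_{m_1}\to T)\leftarrow x_s\leftarrow\cdots\leftarrow x_1,$$ where $a_{m_1}$ is inserted first. A skew diagram $\alpha/\beta$ (with $\beta\subseteq\alpha$) is a \emph{horizontal strip} if no two of its boxes lie in the same column, and $|\alpha/\beta|$ is its number of boxes. \textbf{Theorem.} Let $T$ be an $spo$-tableau of shape $\lambda$ and $U$ a one-row $spo$-tableau of shape $(k)$ as above. Then $T\cdot U$ is formed in three stages: for some $0\le m_2\le s$, \begin{enumerate} \item an addition stage yields $T_{\mu^\circ}=a_1\to\cdots\to a_{m_1}\to T$, every insertion adding a box; \item a cancellation stage yields $T_{\mu^-}=T_{\mu^\circ}\leftarrow x_s\leftarrow\cdots\leftarrow x_{m_2+1}$, every insertion causing a cancellation; \item an addition stage yields $T_\nu=T_{\mu^-}\leftarrow x_{m_2}\leftarrow\cdots\leftarrow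 x_1$, every insertion adding a box; \end{enumerate} and $T\cdot U=T_\nu$. Here $T_{\mu^\circ},T_{\mu^-},T_\nu$ are $spo$-tableaux of shapes $\mu^\circ,\mu^-,\nu$, and, with $\ell=s-m_2$: \begin{enumerate} \item $\mu^\circ/\lambda$, $\mu^\circ/\mu^-$ and $\nu/\mu^-$ are horizontal strips; \item $|\mu^\circ/\lambda|=m_1$ and $0\le m_1\le k$; \item $|\mu^\circ/\mu^-|=\ell$ and $0\le\ell\le k-m_1$; and if the first rows of $\lambda$ and $\mu^\circ$ have different lengths, then the first rows of $\mu^\circ$ and $\mu^-$ have the same length; \item $|\nu/\mu^-|=k-m_1-\ell$, and every box of $\nu/\mu^-$ lies in a column strictly to the right of every box of $\mu^\circ/\lambda$. \end{enumerate} -/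

import Mathlib

/-- The symplectic letters `B₀ = {1 < 1̄ < 2 < 2̄ < ⋯ < m < m̄}` with the lexicographic order:
the pair `(p, false)` is the letter `p + 1`, the pair `(p, true)` is the letter `p + 1` barred. -/
abbrev B0 (m : ℕ) : Type := Fin m ×ₗ Bool

/-- The letters `B₁ = {1° < 2° < ⋯ < n°}`; `q : Fin n` is the letter `(q + 1)°`. -/
abbrev B1 (n : ℕ) : Type := Fin n

/-- The alphabet `B = B₀ ∪ B₁`, ordered so that every letter of `B₀` precedes every letter
of `B₁`. -/
abbrev Letter (m n : ℕ) : Type := B0 m ⊕ₗ B1 n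

/-- An array of boxes in the plane filled with letters: `T i j` is the entry of the box in row `i`
and column `j` (rows and columns counted from `0`, rows downwards), and `none` if there is no
such entry. -/
abbrev Filling (m n : ℕ) : Type := ℕ → ℕ → Option (Letter m n)

namespace Filling

variable {m n : ℕ}

/-- Put the letter `e` into box `(i, j)`, in place of whatever stood there. -/
def put (T : Filling m n) (i j : ℕ) (e : Letter m n) : Filling m n :=
  Function.update T i (Function.update (T i) j (some e))

/-- Remove the entry of box `(i, j)`. -/
def erase (T : Filling m n) (i j : ℕ) : Filling m n :=
  Function.update T i (Function.update (T i) j none)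

end Filling

/-- `T` is an `spo(2m,n)`-tableau of shape `μ`. -/
structure IsSpoTableau {m n : ℕ} (T : Filling m n) (μ : YoungDiagram) : Prop where
  /-- exactly the boxes of `μ` are filled -/
  shape : ∀ i j, (T i j).isSome ↔ (i, j) ∈ μ
  /-- the boxes with entries in `B₀` form a Young diagram -/
  even_shape : ∃ κ : YoungDiagram, ∀ i j, (∃ x : B0 m, T i j = some (Sum.inlₗ x)) ↔ (i, j) ∈ κ
  /-- the `B₀`-portion increases weakly along rows -/
  even_row : ∀ i j j' (x x' : B0 m), j < j' →
    T i j = some (Sum.inlₗ x) → T i j' = some (Sum.inlₗ x') → x ≤ x'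
  /-- the `B₀`-portion increases strictly down columns -/
  even_col : ∀ i i' j (x x' : B0 m), i < i' →
    T i j = some (Sum.inlₗ x) → T i' j = some (Sum.inlₗ x') → x < x'
  /-- symplectic condition: with rows counted from `1`, the `B₀`-entries of the `i`-th row are at
  least `i` (in particular there are no `B₀`-entries below the `m`-th row) -/
  symplectic : ∀ i j (x : B0 m), T i j = some (Sum.inlₗ x) → i ≤ (ofLex x).1.val
  /-- the `B₁`-portion increases strictly along rows -/
  odd_row : ∀ i j j' (y y' : B1 n), j < j' →
    T i j = some (Sum.inrₗ y) → T i j' = some (Sum.inrₗ y') → y < y'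
  /-- the `B₁`-portion increases weakly down columns -/
  odd_col : ∀ i i' j (y y' : B1 n), i < i' →
    T i j = some (Sum.inrₗ y) → T i' j = some (Sum.inrₗ y') → y ≤ y'

/-- The states of the insertion process. -/
inductive InsState (m n : ℕ) : Type
  /-- the letter `x ∈ B₀` is to be inserted into row `i` of `T` -/
  | row (T : Filling m n) (i : ℕ) (x : B0 m)
  /-- the letter `y ∈ B₁` is to be inserted into column `j` of `T` -/
  | col (T : Filling m n) (j : ℕ) (y : B1 n)
  /-- a cancellation has occurred and the empty box is now at `(i, j)` -/
  | hole (T : Filling m n) (i j : ℕ)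
  /-- finished, the last letter having landed in a new box -/
  | added (T : Filling m n)
  /-- finished, the empty box having moved to an outer corner, where it is removed -/
  | cancelled (T : Filling m n)

namespace InsState

variable {m n : ℕ}

/-- The filling carried by a state. -/
def filling : InsState m n → Filling m n
  | row T _ _ => T
  | col T _ _ => T
  | hole T _ _ => T
  | added T => T
  | cancelled T => T

/-- A letter displaced from box `(i, j)` goes to the next row if it lies in `B₀`, and to the next
column if it lies in `B₁`. -/
def displaced (T : Filling m n) (i j : ℕ) (e : Letter m n) : InsState m n :=
  match ofLex e with
  | Sum.inl x => row T (i + 1) x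
  | Sum.inr y => col T (j + 1) y

/-- The column in which `x ∈ B₀` is placed when inserted into row `i`: that of the leftmost entry
larger than `x` or, if there is none, of the first box after the end of the row. -/
noncomputable def rowPos (T : Filling m n) (i : ℕ) (x : B0 m) : ℕ :=
  sInf {j | ∀ e, T i j = some e → Sum.inlₗ x < e}

/-- The row in which `y ∈ B₁` is placed when inserted into column `j`: that of the topmost entry
larger than `y` or, if there is none, of the first box below the end of the column. -/
noncomputable def colPos (T : Filling m n) (j : ℕ) (y : B1 n) : ℕ :=
  sInf {i | ∀ e, T i j = some e → Sum.inrₗ y < e}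

/-- Replacing the entry `e` in row `i` by `x` would replace a barred `i` by the letter `i` in
row `i` (rows counted from `1`). -/
def IsCancellation (i : ℕ) (x : B0 m) (e : Letter m n) : Prop :=
  ∃ p : Fin m, p.val = i ∧ x = toLex (p, false) ∧ e = Sum.inlₗ (toLex (p, true))

/-- In a forward slide, the entry `a` to the right of the empty box (rather than the entry `b`
below it) moves into the empty box. -/
def SlidesLeft (a b : Letter m n) : Prop :=
  a < b ∨ (a = b ∧ ∃ y : B1 n, a = Sum.inrₗ y)

open Classical in
/-- One step of the insertion process. -/
noncomputable def step : InsState m n → Option (InsState m n)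
  | row T i x =>
    let j := rowPos T i x
    match T i j with
    | none => some (added (T.put i j (Sum.inlₗ x)))
    | some e =>
      if IsCancellation i x e then some (hole (T.erase i j) i j)
      else some (displaced (T.put i j (Sum.inlₗ x)) i j e)
  | col T j y =>
    let i := colPos T j y
    match T i j with
    | none => some (added (T.put i j (Sum.inrₗ y)))
    | some e => some (displaced (T.put i j (Sum.inrₗ y)) i j e)
  | hole T i j =>
    match T i (j + 1), T (i + 1) j with
    | none, none => some (cancelled T)
    | some a, none => some (hole ((T.put i j a).erase i (j + 1)) i (j + 1))
    | none, some b => some (hole ((T.put i j b).erase (i + 1) j) (i + 1) j)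
    | some a, some b =>
      if SlidesLeft a b then some (hole ((T.put i j a).erase i (j + 1)) i (j + 1))
      else some (hole ((T.put i j b).erase (i + 1) j) (i + 1) j)
  | added _ => none
  | cancelled _ => none

/-- The final state of the process started in a given state (undefined if the process does not
stop). -/
noncomputable def run (s : InsState m n) : Part (InsState m n) :=
  StateTransition.eval step s

end InsState

namespace Filling

variable {m n : ℕ}

/-- `T ← x` for `x ∈ B₀`. -/
noncomputable def rowInsert (T : Filling m n) (x : B0 m) : Part (Filling m n) :=
  (InsState.run (.row T 0 x)).map InsState.filling

/-- `y → T` for `y ∈ B₁`. -/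
noncomputable def colInsert (T : Filling m n) (y : B1 n) : Part (Filling m n) :=
  (InsState.run (.col T 0 y)).map InsState.filling

/-- `T ← x₁ ← x₂ ← ⋯ ← x_r`. -/
noncomputable def rowInsertWord (T : Filling m n) (x : List (B0 m)) : Part (Filling m n) :=
  x.foldlM rowInsert T

/-- `y₁ → y₂ → ⋯ → y_r → T`, where `y_r` is inserted first. -/
noncomputable def colInsertWord (y : List (B1 n)) (T : Filling m n) : Part (Filling m n) :=
  y.reverse.foldlM colInsert T

/-- The first `k` entries of the first row, from left to right. -/
def rowWord (U : Filling m n) (k : ℕ) : List (Letter m n) :=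
  (List.range k).filterMap (U 0)

/-- The entries in `B₀` among the first `k` entries of the first row, from left to right. -/
def evenLetters (U : Filling m n) (k : ℕ) : List (B0 m) :=
  (rowWord U k).filterMap fun e => (ofLex e).getLeft?

/-- The entries in `B₁` among the first `k` entries of the first row, from left to right. -/
def oddLetters (U : Filling m n) (k : ℕ) : List (B1 n) :=
  (rowWord U k).filterMap fun e => (ofLex e).getRight?

/-- The product `T · U` with a one-row tableau `U` that has `k` boxes. -/
noncomputable def mulRow (T U : Filling m n) (k : ℕ) : Part (Filling m n) :=
  (colInsertWord (oddLetters U k) T).bind fun S => rowInsertWord S (evenLetters U k)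

/-- Inserting `x ∈ B₀` into `T` causes no cancellation and yields `T'`. -/
def RowAdds (T : Filling m n) (x : B0 m) (T' : Filling m n) : Prop :=
  InsState.added T' ∈ InsState.run (.row T 0 x)

/-- Inserting `x ∈ B₀` into `T` causes a cancellation and yields `T'`. -/
def RowCancels (T : Filling m n) (x : B0 m) (T' : Filling m n) : Prop :=
  InsState.cancelled T' ∈ InsState.run (.row T 0 x)

/-- Inserting `y ∈ B₁` into `T` causes no cancellation and yields `T'`. -/
def ColAdds (T : Filling m n) (y : B1 n) (T' : Filling m n) : Prop :=
  InsState.added T' ∈ InsState.run (.col T 0 y)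

/-- `T'` results from `T` by processing the letters of a word from left to right, each of them
by a transition in `R`. -/
def Chain {α : Type} (R : Filling m n → α → Filling m n → Prop) :
    Filling m n → List α → Filling m n → Prop
  | T, [], T' => T = T'
  | T, x :: w, T' => ∃ S, R T x S ∧ Chain R S w T'

end Filling

/-- The Young diagram of shape `(k)`, a single row of `k` boxes. -/
def rowDiagram (k : ℕ) : YoungDiagram := YoungDiagram.ofRowLens [k] (List.pairwise_singleton _ _).sortedGE

/-- The set of boxes of the skew diagram `lam / mu`. -/
def skewCells (lam mu : YoungDiagram) : Finset (ℕ × ℕ) := lam.cells \ mu.cells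

/-- `lam / mu` is a horizontal strip. -/
def IsHorizontalStrip (lam mu : YoungDiagram) : Prop :=
  mu ≤ lam ∧ ∀ b ∈ skewCells lam mu, ∀ c ∈ skewCells lam mu, b.2 = c.2 → b = c

/-! Two relations replace the separate rules for `B₀` and `B₁`: `RowLT` along rows and `ColLT` down
columns. Equality is allowed for letters of `B₀` in the first and for letters of `B₁` in the second,
so each is the negation of the other reversed, and composing the two is strict. Every tableau check
then compares two boxes through the box completing the rectangle. Each insertion adds or removes a
single box at a corner. What has to be shown is where successive boxes lie; for this, each insertion
leaves a trace in the filling that constrains the next one.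

A column insertion leaves a `ColChain`: its bumping path, made of letters of `B₁` in consecutive
columns. If the next letter is smaller than the first letter of the chain, the letter it displaces
is at most the chain's letter in that column, hence smaller than the chain's next letter. So the new
path cannot end before passing the last column of the chain (`exists_reaches_col`). Decreasing
letters of `B₁` therefore add boxes strictly to the right of each other.

A row insertion leaves a `Guard`: in each row that it bumped, a letter `u` with the displaced letter
`v` a lower bound for everything to the right of `u`. A later letter that is at least as large
passes strictly to the right of `u`, displaces something at least `v`, and cannot cancel there
because `v` is too large for that row. After an addition the guard covers all rows that a letter of
`B₀` can enter (`i₀ = m`), so no cancellation follows and the new boxes move to the right. After a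
cancellation the guard reaches the row of the cancellation, so the next cancellation occurs in that
row or below.

A slide leaves a `Trail`: the column in which the empty box left each row. An empty box that starts
to the left of the trail is forced down before crossing it, hence ends at least as low as the
earlier one (`exists_reaches_hole`). Corners removed in weakly lower and lower rows lie in strictly
decreasing columns.

Finally, a `ColChain` starting in the first column survives slides, with its last entry in the same
column and weakly higher. The chain of the last letter of `B₁`, which ends at the rightmost added
box, thus persists until the last stage. It forces the later boxes to its right, and it keeps the
first row from shrinking if that box lies in the first row. -/

open StateTransition

/-! ### Row and column order of letters -/

namespace Letter

variable {m n : ℕ}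

/-- The relation between two entries of a row, read from left to right. -/
def RowLT (a b : Letter m n) : Prop := a < b ∨ (a = b ∧ ∃ x : B0 m, a = Sum.inlₗ x)

/-- The relation between two entries of a column, read from top to bottom. -/
abbrev ColLT (a b : Letter m n) : Prop := InsState.SlidesLeft a b

theorem even_or_odd (a : Letter m n) :
    (∃ x : B0 m, a = Sum.inlₗ x) ∨ ∃ y : B1 n, a = Sum.inrₗ y := by
  rcases h : ofLex a with x | y
  · exact Or.inl ⟨x, ofLex.injective h⟩
  · exact Or.inr ⟨y, ofLex.injective h⟩

theorem even_inj {x x' : B0 m} : (Sum.inlₗ x : Letter m n) = Sum.inlₗ x' ↔ x = x' :=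
  ⟨fun h => Sum.inl_injective (toLex.injective h), fun h => h ▸ rfl⟩

theorem even_ne_odd {x : B0 m} {y : B1 n} : (Sum.inlₗ x : Letter m n) ≠ Sum.inrₗ y :=
  fun h => Sum.inl_ne_inr (toLex.injective h)

theorem even_lt_even {x x' : B0 m} : (Sum.inlₗ x : Letter m n) < Sum.inlₗ x' ↔ x < x' :=
  Sum.Lex.inl_lt_inl_iff

theorem even_le_even {x x' : B0 m} : (Sum.inlₗ x : Letter m n) ≤ Sum.inlₗ x' ↔ x ≤ x' :=
  Sum.Lex.inl_le_inl_iff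

theorem odd_lt_odd {y y' : B1 n} : (Sum.inrₗ y : Letter m n) < Sum.inrₗ y' ↔ y < y' :=
  Sum.Lex.inr_lt_inr_iff

theorem odd_le_odd {y y' : B1 n} : (Sum.inrₗ y : Letter m n) ≤ Sum.inrₗ y' ↔ y ≤ y' :=
  Sum.Lex.inr_le_inr_iff

theorem even_lt_odd {x : B0 m} {y : B1 n} : (Sum.inlₗ x : Letter m n) < Sum.inrₗ y :=
  Sum.Lex.inl_lt_inr _ _

theorem exists_odd_of_odd_lt {y : B1 n} {a : Letter m n} (h : Sum.inrₗ y < a) :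
    ∃ y', a = Sum.inrₗ y' ∧ y < y' := by
  obtain ⟨x, rfl⟩ | ⟨y', rfl⟩ := even_or_odd a
  · exact absurd h (even_lt_odd (m := m)).not_gt
  · exact ⟨y', rfl, odd_lt_odd.1 h⟩

theorem exists_even_of_le_even {x : B0 m} {a : Letter m n} (h : a ≤ Sum.inlₗ x) :
    ∃ x', a = Sum.inlₗ x' ∧ x' ≤ x := by
  obtain ⟨x', rfl⟩ | ⟨y', rfl⟩ := even_or_odd a
  · exact ⟨x', rfl, even_le_even.1 h⟩
  · exact absurd h (even_lt_odd (m := m)).not_ge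

theorem RowLT.le {a b : Letter m n} (h : RowLT a b) : a ≤ b := by
  rcases h with h | ⟨h, -⟩
  exacts [h.le, h.le]

theorem ColLT.le {a b : Letter m n} (h : ColLT a b) : a ≤ b := by
  rcases h with h | ⟨h, -⟩
  exacts [h.le, h.le]

theorem RowLT.trans {a b c : Letter m n} (h : RowLT a b) (h' : RowLT b c) : RowLT a c := by
  rcases h with h | ⟨rfl, -⟩
  · exact Or.inl (h.trans_le h'.le)
  · exact h'

theorem ColLT.trans {a b c : Letter m n} (h : ColLT a b) (h' : ColLT b c) : ColLT a c := by
  rcases h with h | ⟨rfl, -⟩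
  · exact Or.inl (h.trans_le (ColLT.le h'))
  · exact h'

/-- Both relations could be equalities only if `b` belonged to `B₀` and to `B₁`. This is how entries
are compared around a corner of a rectangle of boxes. -/
theorem RowLT.lt_of_colLT {a b c : Letter m n} (h : RowLT a b) (h' : ColLT b c) : a < c := by
  rcases h with h | ⟨rfl, x, rfl⟩
  · exact h.trans_le (ColLT.le h')
  · rcases h' with h' | ⟨-, y, hy⟩
    exacts [h', absurd hy even_ne_odd]

theorem ColLT.lt_of_rowLT {a b c : Letter m n} (h : ColLT a b) (h' : RowLT b c) : a < c := by
  rcases h with h | ⟨rfl, y, rfl⟩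
  · exact h.trans_le h'.le
  · rcases h' with h' | ⟨-, x, hx⟩
    exacts [h', absurd hx.symm even_ne_odd]

theorem rowLT_of_not_colLT {a b : Letter m n} (h : ¬ColLT a b) : RowLT b a := by
  rcases lt_trichotomy a b with h' | rfl | h'
  · exact absurd (Or.inl h') h
  · rcases even_or_odd a with ⟨x, hx⟩ | ⟨y, hy⟩
    · exact Or.inr ⟨rfl, x, hx⟩
    · exact absurd (Or.inr ⟨rfl, y, hy⟩) h
  · exact Or.inl h'

theorem RowLT.not_colLT {a b : Letter m n} (h : RowLT b a) : ¬ColLT a b := fun h' =>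
  (h.lt_of_colLT h').false

theorem rowLT_even {a : Letter m n} {x : B0 m} (h : a ≤ Sum.inlₗ x) : RowLT a (Sum.inlₗ x) := by
  rcases h.lt_or_eq with h | h
  exacts [Or.inl h, Or.inr ⟨h, x, h⟩]

theorem colLT_odd {a : Letter m n} {y : B1 n} (h : a ≤ Sum.inrₗ y) : ColLT a (Sum.inrₗ y) := by
  rcases h.lt_or_eq with h | h
  exacts [Or.inl h, Or.inr ⟨h, y, h⟩]

theorem RowLT.lt_odd {a : Letter m n} {y : B1 n} (h : RowLT a (Sum.inrₗ y)) :
    a < Sum.inrₗ y := by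
  rcases h with h | ⟨rfl, x, hx⟩
  exacts [h, absurd hx.symm even_ne_odd]

theorem RowLT.odd_lt {a : Letter m n} {y : B1 n} (h : RowLT (Sum.inrₗ y) a) :
    Sum.inrₗ y < a := by
  rcases h with h | ⟨-, x, hx⟩
  exacts [h, absurd hx.symm even_ne_odd]

theorem ColLT.lt_even {a : Letter m n} {x : B0 m} (h : ColLT a (Sum.inlₗ x)) :
    a < Sum.inlₗ x := by
  rcases h with h | ⟨rfl, y, hy⟩
  exacts [h, absurd hy even_ne_odd]

end Letter

open Letter

/-! ### Changing single boxes; tableaux on arbitrary sets of boxes, so that an empty box is allowed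
-/

namespace Filling

variable {m n : ℕ}

theorem put_self (T : Filling m n) (i j : ℕ) (e : Letter m n) : T.put i j e i j = some e := by
  simp [put]

theorem put_of_ne (T : Filling m n) {i j k l : ℕ} (e : Letter m n) (h : (k, l) ≠ (i, j)) :
    T.put i j e k l = T k l := by
  by_cases hk : k = i
  · subst hk
    have hl : l ≠ j := fun hl => h (by rw [hl])
    simp [put, hl]
  · simp [put, hk]

theorem erase_self (T : Filling m n) (i j : ℕ) : T.erase i j i j = none := by
  simp [erase]

theorem erase_of_ne (T : Filling m n) {i j k l : ℕ} (h : (k, l) ≠ (i, j)) :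
    T.erase i j k l = T k l := by
  by_cases hk : k = i
  · subst hk
    have hl : l ≠ j := fun hl => h (by rw [hl])
    simp [erase, hl]
  · simp [erase, hk]

/-- Exactly the boxes in `A` are filled, with entries that satisfy the conditions on the rows,
columns and entries of a tableau. -/
structure Tab (T : Filling m n) (A : Set (ℕ × ℕ)) : Prop where
  shape : ∀ i j, (T i j).isSome ↔ (i, j) ∈ A
  row : ∀ i j j' a b, j < j' → T i j = some a → T i j' = some b → RowLT a b
  col : ∀ i i' j a b, i < i' → T i j = some a → T i' j = some b → ColLT a b
  symplectic : ∀ i j (x : B0 m), T i j = some (Sum.inlₗ x) → i ≤ (ofLex x).1.val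

namespace Tab

variable {T : Filling m n} {A : Set (ℕ × ℕ)}

theorem mem (h : Tab T A) {i j : ℕ} {a : Letter m n} (ha : T i j = some a) : (i, j) ∈ A :=
  (h.shape i j).1 (by rw [ha]; rfl)

theorem exists_of_mem (h : Tab T A) {i j : ℕ} (ha : (i, j) ∈ A) : ∃ a, T i j = some a :=
  Option.isSome_iff_exists.1 ((h.shape i j).2 ha)

theorem eq_none (h : Tab T A) {i j : ℕ} (ha : (i, j) ∉ A) : T i j = none := by
  rw [← h.shape] at ha
  simpa using ha

theorem not_mem (h : Tab T A) {i j : ℕ} (ha : T i j = none) : (i, j) ∉ A := by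
  rw [← h.shape, ha]
  simp

/-- Filling the box `(i, j)` anew with a letter that fits there. -/
theorem put (h : Tab T A) {A' : Set (ℕ × ℕ)} {i j : ℕ} {e : Letter m n}
    (hA : ∀ c, c ∈ A' ↔ c = (i, j) ∨ c ∈ A)
    (hl : ∀ c a, c < j → T i c = some a → RowLT a e)
    (hr : ∀ c a, j < c → T i c = some a → RowLT e a)
    (hu : ∀ k a, k < i → T k j = some a → ColLT a e)
    (hd : ∀ k a, i < k → T k j = some a → ColLT e a)
    (hs : ∀ x : B0 m, e = Sum.inlₗ x → i ≤ (ofLex x).1.val) : Tab (T.put i j e) A' where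
  shape k l := by
    rw [hA]
    by_cases hkl : (k, l) = (i, j)
    · obtain ⟨rfl, rfl⟩ := Prod.mk.inj hkl
      simp [put_self]
    · rw [put_of_ne _ _ hkl, h.shape]
      simp [hkl]
  row k l l' a b hll ha hb := by
    by_cases h1 : (k, l) = (i, j)
    · obtain ⟨rfl, rfl⟩ := Prod.mk.inj h1
      rw [put_self] at ha
      rw [put_of_ne _ _ (by simp; omega)] at hb
      obtain rfl := Option.some.inj ha
      exact hr _ _ hll hb
    · rw [put_of_ne _ _ h1] at ha
      by_cases h2 : (k, l') = (i, j)
      · obtain ⟨rfl, rfl⟩ := Prod.mk.inj h2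
        rw [put_self] at hb
        obtain rfl := Option.some.inj hb
        exact hl _ _ hll ha
      · rw [put_of_ne _ _ h2] at hb
        exact h.row _ _ _ _ _ hll ha hb
  col k k' l a b hkk ha hb := by
    by_cases h1 : (k, l) = (i, j)
    · obtain ⟨rfl, rfl⟩ := Prod.mk.inj h1
      rw [put_self] at ha
      rw [put_of_ne _ _ (by simp; omega)] at hb
      obtain rfl := Option.some.inj ha
      exact hd _ _ hkk hb
    · rw [put_of_ne _ _ h1] at ha
      by_cases h2 : (k', l) = (i, j)
      · obtain ⟨rfl, rfl⟩ := Prod.mk.inj h2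
        rw [put_self] at hb
        obtain rfl := Option.some.inj hb
        exact hu _ _ hkk ha
      · rw [put_of_ne _ _ h2] at hb
        exact h.col _ _ _ _ _ hkk ha hb
  symplectic k l x hx := by
    by_cases h1 : (k, l) = (i, j)
    · obtain ⟨rfl, rfl⟩ := Prod.mk.inj h1
      rw [put_self] at hx
      exact hs x (Option.some.inj hx)
    · rw [put_of_ne _ _ h1] at hx
      exact h.symplectic _ _ _ hx

theorem erase (h : Tab T A) (i j : ℕ) : Tab (T.erase i j) (A \ {(i, j)}) := by
  have key : ∀ k l a, T.erase i j k l = some a → T k l = some a := by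
    intro k l a ha
    by_cases hkl : (k, l) = (i, j)
    · obtain ⟨rfl, rfl⟩ := Prod.mk.inj hkl
      rw [erase_self] at ha
      cases ha
    · rwa [erase_of_ne _ hkl] at ha
  refine ⟨fun k l => ?_, fun k l l' a b hll ha hb => h.row _ _ _ _ _ hll (key _ _ _ ha)
    (key _ _ _ hb), fun k k' l a b hkk ha hb => h.col _ _ _ _ _ hkk (key _ _ _ ha)
    (key _ _ _ hb), fun k l x hx => h.symplectic _ _ _ (key _ _ _ hx)⟩
  by_cases hkl : (k, l) = (i, j)
  · obtain ⟨rfl, rfl⟩ := Prod.mk.inj hkl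
    simp [erase_self]
  · rw [erase_of_ne _ hkl, h.shape]
    simp [hkl]

/-- In a tableau of straight shape, entries weakly increase to the south-east. -/
theorem le_of_le {μ : YoungDiagram} (h : Tab T {c | c ∈ μ}) {i i' j j' : ℕ} {a b : Letter m n}
    (hi : i ≤ i') (hj : j ≤ j') (ha : T i j = some a) (hb : T i' j' = some b) : a ≤ b := by
  have hc : (i, j') ∈ μ := μ.up_left_mem hi le_rfl (h.mem hb)
  obtain ⟨c, hc⟩ := h.exists_of_mem hc
  have h1 : a ≤ c := by
    rcases hj.lt_or_eq with hj | rfl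
    · exact (h.row _ _ _ _ _ hj ha hc).le
    · exact (Option.some.inj (ha.symm.trans hc)).le
  have h2 : c ≤ b := by
    rcases hi.lt_or_eq with hi | rfl
    · exact ColLT.le (h.col _ _ _ _ _ hi hc hb)
    · exact (Option.some.inj (hc.symm.trans hb)).le
  exact h1.trans h2

end Tab

end Filling

open Filling

/-- The Young diagram of the `B₀`-entries amounts to no letter of `B₁` standing to the left of or
above a letter of `B₀`; conversely, entries weakly increase to the south-east and `B₀` precedes
`B₁`. -/
theorem isSpoTableau_iff {m n : ℕ} {T : Filling m n} {μ : YoungDiagram} :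
    IsSpoTableau T μ ↔ Tab T {c | c ∈ μ} := by
  constructor
  · intro h
    obtain ⟨κ, hκ⟩ := h.even_shape
    refine ⟨h.shape, ?_, ?_, h.symplectic⟩
    · intro i j j' a b hj ha hb
      obtain ⟨x, rfl⟩ | ⟨y, rfl⟩ := even_or_odd a <;> obtain ⟨x', rfl⟩ | ⟨y', rfl⟩ := even_or_odd b
      · exact rowLT_even (even_le_even.2 (h.even_row _ _ _ _ _ hj ha hb))
      · exact Or.inl even_lt_odd
      · obtain ⟨x, hx⟩ := (hκ i j).2 (κ.up_left_mem le_rfl hj.le ((hκ i j').1 ⟨x', hb⟩))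
        exact absurd (Option.some.inj (hx.symm.trans ha)) even_ne_odd
      · exact Or.inl (odd_lt_odd.2 (h.odd_row _ _ _ _ _ hj ha hb))
    · intro i i' j a b hi ha hb
      obtain ⟨x, rfl⟩ | ⟨y, rfl⟩ := even_or_odd a <;> obtain ⟨x', rfl⟩ | ⟨y', rfl⟩ := even_or_odd b
      · exact Or.inl (even_lt_even.2 (h.even_col _ _ _ _ _ hi ha hb))
      · exact Or.inl even_lt_odd
      · obtain ⟨x, hx⟩ := (hκ i j).2 (κ.up_left_mem hi.le le_rfl ((hκ i' j).1 ⟨x', hb⟩))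
        exact absurd (Option.some.inj (hx.symm.trans ha)) even_ne_odd
      · exact colLT_odd (odd_le_odd.2 (h.odd_col _ _ _ _ _ hi ha hb))
  · intro h
    classical
    refine ⟨h.shape, ?_, ?_, ?_, h.symplectic, ?_, ?_⟩
    · refine ⟨⟨μ.cells.filter fun c => ∃ x : B0 m, T c.1 c.2 = some (Sum.inlₗ x), ?_⟩, ?_⟩
      · rintro ⟨i', j'⟩ ⟨i, j⟩ ⟨hi, hj⟩ hc
        simp only [Finset.coe_filter, Set.mem_ofPred_eq, YoungDiagram.mem_cells] at hc ⊢
        obtain ⟨hc, x, hx⟩ := hc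
        have hm := μ.up_left_mem hi hj hc
        obtain ⟨a, ha⟩ := h.exists_of_mem hm
        obtain ⟨x', rfl, -⟩ := exists_even_of_le_even (h.le_of_le hi hj ha hx)
        exact ⟨hm, x', ha⟩
      · intro i j
        rw [← YoungDiagram.mem_cells]
        simp only [Finset.mem_filter, YoungDiagram.mem_cells]
        exact ⟨fun ⟨x, hx⟩ => ⟨h.mem hx, x, hx⟩, fun hx => hx.2⟩
    · exact fun i j j' x x' hj hx hx' => even_le_even.1 (h.row _ _ _ _ _ hj hx hx').le
    · exact fun i i' j x x' hi hx hx' => even_lt_even.1 (ColLT.lt_even (h.col _ _ _ _ _ hi hx hx'))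
    · exact fun i j j' x x' hj hx hx' => odd_lt_odd.1 (h.row _ _ _ _ _ hj hx hx').lt_odd
    · exact fun i i' j x x' hi hx hx' => odd_le_odd.1 (ColLT.le (h.col _ _ _ _ _ hi hx hx'))

open StateTransition Letter Filling

/-! ### Adding and removing a corner -/

namespace YoungDiagram

/-- The diagram `μ'` arises from `μ` by adding the box `c`. -/
def AddBox (μ : YoungDiagram) (c : ℕ × ℕ) (μ' : YoungDiagram) : Prop :=
  c ∉ μ ∧ ∀ d, d ∈ μ' ↔ d = c ∨ d ∈ μ

theorem exists_addBox (μ : YoungDiagram) {i j : ℕ} (h : (i, j) ∉ μ) (hu : ∀ k < i, (k, j) ∈ μ)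
    (hl : ∀ c < j, (i, c) ∈ μ) : ∃ μ', μ.AddBox (i, j) μ' := by
  refine ⟨⟨insert (i, j) μ.cells, ?_⟩, h, fun d => ?_⟩
  · rintro ⟨i', j'⟩ ⟨k, l⟩ ⟨hk, hl'⟩ hc
    simp only [Finset.coe_insert, Set.mem_insert_iff, Finset.mem_coe, mem_cells] at hc ⊢
    simp only at hk hl'
    rcases hc with hc | hc
    · obtain ⟨rfl, rfl⟩ := Prod.mk.inj hc
      rcases hk.lt_or_eq with hk | rfl
      · exact Or.inr (μ.up_left_mem le_rfl hl' (hu k hk))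
      · rcases hl'.lt_or_eq with hl' | rfl
        · exact Or.inr (hl l hl')
        · exact Or.inl rfl
    · exact Or.inr (μ.up_left_mem hk hl' hc)
  · rw [← mem_cells]
    simp

theorem exists_removeBox (μ : YoungDiagram) {i j : ℕ} (h : (i, j) ∈ μ) (hd : (i + 1, j) ∉ μ)
    (hr : (i, j + 1) ∉ μ) : ∃ μ' : YoungDiagram, μ'.AddBox (i, j) μ := by
  refine ⟨⟨μ.cells.erase (i, j), ?_⟩, ?_, fun d => ?_⟩
  · rintro ⟨i', j'⟩ ⟨k, l⟩ ⟨hk, hl⟩ hc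
    simp only [Finset.coe_erase, Set.mem_sdiff, Finset.mem_coe, mem_cells,
      Set.mem_singleton_iff] at hc ⊢
    refine ⟨μ.up_left_mem hk hl hc.1, fun hkl => ?_⟩
    obtain ⟨rfl, rfl⟩ := Prod.mk.inj hkl
    simp only at hk hl
    rcases hk.lt_or_eq with hk | rfl
    · exact hd (μ.up_left_mem hk hl hc.1)
    · rcases hl.lt_or_eq with hl | rfl
      · exact hr (μ.up_left_mem le_rfl hl hc.1)
      · exact hc.2 rfl
  · rw [← mem_cells]
    simp
  · change d ∈ μ ↔ d = (i, j) ∨ d ∈ μ.cells.erase (i, j)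
    by_cases hd : d = (i, j)
    · simp [hd, h]
    · simp [hd]

end YoungDiagram

/-! ### Insertion positions and single steps -/

namespace InsState

variable {m n : ℕ} {T : Filling m n}

/-- A vacant box makes the set defining `rowPos` nonempty, so the infimum is attained and is not the
default value `0`. -/
theorem rowPos_lt {i : ℕ} {x : B0 m} (h : ∃ j, T i j = none) {e : Letter m n}
    (he : T i (rowPos T i x) = some e) : Sum.inlₗ x < e := by
  obtain ⟨j, hj⟩ := h
  have := Nat.sInf_mem (s := {j | ∀ e, T i j = some e → Sum.inlₗ x < e}) ⟨j, by simp [hj]⟩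
  exact this e he

theorem rowPos_le {i j : ℕ} {x : B0 m} (h : ∀ e, T i j = some e → Sum.inlₗ x < e) :
    rowPos T i x ≤ j :=
  Nat.sInf_le h

theorem exists_le_of_lt_rowPos {i j : ℕ} {x : B0 m} (h : j < rowPos T i x) :
    ∃ e, T i j = some e ∧ e ≤ Sum.inlₗ x := by
  have := Nat.notMem_of_lt_sInf h
  change ¬(∀ e, T i j = some e → Sum.inlₗ x < e) at this
  push Not at this
  exact this

theorem colPos_lt {j : ℕ} {y : B1 n} (h : ∃ i, T i j = none) {e : Letter m n}
    (he : T (colPos T j y) j = some e) : Sum.inrₗ y < e := by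
  obtain ⟨i, hi⟩ := h
  have := Nat.sInf_mem (s := {i | ∀ e, T i j = some e → Sum.inrₗ y < e}) ⟨i, by simp [hi]⟩
  exact this e he

theorem colPos_le {i j : ℕ} {y : B1 n} (h : ∀ e, T i j = some e → Sum.inrₗ y < e) :
    colPos T j y ≤ i :=
  Nat.sInf_le h

theorem exists_le_of_lt_colPos {i j : ℕ} {y : B1 n} (h : i < colPos T j y) :
    ∃ e, T i j = some e ∧ e ≤ Sum.inrₗ y := by
  have := Nat.notMem_of_lt_sInf h
  change ¬(∀ e, T i j = some e → Sum.inrₗ y < e) at this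
  push Not at this
  exact this

theorem step_row_none {i : ℕ} {x : B0 m} (h : T i (rowPos T i x) = none) :
    step (.row T i x) = some (.added (T.put i (rowPos T i x) (Sum.inlₗ x))) := by
  simp only [step, h]

theorem step_row_cancel {i : ℕ} {x : B0 m} {e : Letter m n} (h : T i (rowPos T i x) = some e)
    (hc : IsCancellation i x e) :
    step (.row T i x) = some (.hole (T.erase i (rowPos T i x)) i (rowPos T i x)) := by
  simp only [step, h, if_pos hc]

theorem step_row_even {i : ℕ} {x x' : B0 m} (h : T i (rowPos T i x) = some (Sum.inlₗ x'))
    (hc : ¬IsCancellation i x (Sum.inlₗ x' : Letter m n)) :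
    step (.row T i x) = some (.row (T.put i (rowPos T i x) (Sum.inlₗ x)) (i + 1) x') := by
  simp only [step, h, if_neg hc]
  rfl

theorem not_isCancellation_odd {i : ℕ} {x : B0 m} {y : B1 n} :
    ¬IsCancellation i x (Sum.inrₗ y : Letter m n) :=
  fun ⟨_, _, _, h⟩ => even_ne_odd h.symm

theorem step_row_odd {i : ℕ} {x : B0 m} {y : B1 n} (h : T i (rowPos T i x) = some (Sum.inrₗ y)) :
    step (.row T i x) =
      some (.col (T.put i (rowPos T i x) (Sum.inlₗ x)) (rowPos T i x + 1) y) := by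
  simp only [step, h, if_neg not_isCancellation_odd]
  rfl

theorem step_col_none {j : ℕ} {y : B1 n} (h : T (colPos T j y) j = none) :
    step (.col T j y) = some (.added (T.put (colPos T j y) j (Sum.inrₗ y))) := by
  simp only [step, h]

theorem step_col_odd {j : ℕ} {y y' : B1 n} (h : T (colPos T j y) j = some (Sum.inrₗ y')) :
    step (.col T j y) = some (.col (T.put (colPos T j y) j (Sum.inrₗ y)) (j + 1) y') := by
  simp only [step, h]
  rfl

theorem step_hole_none {i j : ℕ} (h : T i (j + 1) = none) (h' : T (i + 1) j = none) :
    step (.hole T i j) = some (.cancelled T) := by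
  simp only [step, h, h']

theorem step_hole_right {i j : ℕ} {a : Letter m n} (h : T i (j + 1) = some a)
    (h' : ∀ b, T (i + 1) j = some b → ColLT a b) :
    step (.hole T i j) = some (.hole ((T.put i j a).erase i (j + 1)) i (j + 1)) := by
  rcases hb : T (i + 1) j with _ | b
  · simp only [step, h, hb]
  · simp only [step, h, hb]
    exact if_pos (h' b hb)

theorem step_hole_down {i j : ℕ} {b : Letter m n} (h : T (i + 1) j = some b)
    (h' : ∀ a, T i (j + 1) = some a → ¬ColLT a b) :
    step (.hole T i j) = some (.hole ((T.put i j b).erase (i + 1) j) (i + 1) j) := by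
  rcases ha : T i (j + 1) with _ | a
  · simp only [step, h, ha]
  · simp only [step, h, ha]
    exact if_neg (h' a ha)

theorem mem_run_of_reaches {s t : InsState m n} (h : Reaches step s t) (ht : step t = none) :
    t ∈ run s :=
  mem_eval.2 ⟨h, ht⟩

theorem reaches_head {s t u : InsState m n} (h : step s = some t) (h' : Reaches step t u) :
    Reaches step s u :=
  Relation.ReflTransGen.head h h'

end InsState

open InsState

/-! ### Column insertion and its bumping path -/

namespace Filling

variable {m n : ℕ}

/-- Letters of `B₁` in the columns `s, …, L`, which increase from column to column in weakly
decreasing rows. -/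
def ColChain (T : Filling m n) (s L : ℕ) (q : ℕ → ℕ) (y : ℕ → B1 n) : Prop :=
  (∀ c, s ≤ c → c ≤ L → T (q c) c = some (Sum.inrₗ (y c))) ∧
    ∀ c, s ≤ c → c < L → q (c + 1) ≤ q c ∧ y c < y (c + 1)

theorem Tab.exists_row_none {T : Filling m n} {μ : YoungDiagram} (h : Tab T {c | c ∈ μ}) (i : ℕ) :
    ∃ j, T i j = none :=
  ⟨μ.rowLen i, h.eq_none fun hm => (YoungDiagram.mem_iff_lt_rowLen.1 hm).false⟩

theorem Tab.exists_col_none {T : Filling m n} {μ : YoungDiagram} (h : Tab T {c | c ∈ μ}) (j : ℕ) :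
    ∃ i, T i j = none :=
  ⟨μ.colLen j, h.eq_none fun hm => (YoungDiagram.mem_iff_lt_colLen.1 hm).false⟩

/-- The insertion of a letter of `B₁` into column `j`, to the right of the letter `w` in
row `i`. -/
theorem exists_reaches_col {μ : YoungDiagram} (d : ℕ) :
    ∀ (T : Filling m n) (i j : ℕ) (z : B1 n), Tab T {c | c ∈ μ} → μ.rowLen 0 ≤ j + d →
    (∀ j₀, j = j₀ + 1 → ∃ w, T i j₀ = some w ∧ RowLT w (Sum.inrₗ z) ∧
      ∀ e, T i j = some e → Sum.inrₗ z < e) →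
    ∃ (T' : Filling m n) (μ' : YoungDiagram) (R L' : ℕ) (q : ℕ → ℕ) (y : ℕ → B1 n),
      Reaches step (.col T j z) (.added T') ∧ μ.AddBox (R, L') μ' ∧ Tab T' {c | c ∈ μ'} ∧
      j ≤ L' ∧ ColChain T' j L' q y ∧ y j = z ∧ q L' = R ∧ (j ≠ 0 → q j ≤ i) ∧
      (∀ k c (x : B0 m), T' k c = some (Sum.inlₗ x) ↔ T k c = some (Sum.inlₗ x)) ∧
      (∀ k c, c < j → T' k c = T k c) ∧
      ∀ L q₀ y₀, ColChain T j L q₀ y₀ → j ≤ L → z < y₀ j → L < L' := by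
  induction d using Nat.strong_induction_on with
  | _ d ih =>
  intro T i j z hT hd hw
  have hlt : ∀ e, T (colPos T j z) j = some e → Sum.inrₗ z < e :=
    fun e => colPos_lt (hT.exists_col_none j)
  have habove : ∀ k < colPos T j z, ∃ e, T k j = some e ∧ e ≤ Sum.inrₗ z :=
    fun k => exists_le_of_lt_colPos
  have hti : j ≠ 0 → colPos T j z ≤ i := fun hj => by
    obtain ⟨j₀, rfl⟩ := Nat.exists_eq_succ_of_ne_zero hj
    obtain ⟨w, -, -, h⟩ := hw j₀ rfl
    exact colPos_le h
  have hmin : ∀ k y, T k j = some (Sum.inrₗ y) → z < y → colPos T j z ≤ k :=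
    fun k y hk hy => colPos_le fun e he => by
      rw [hk] at he
      obtain rfl := Option.some.inj he
      exact odd_lt_odd.2 hy
  have hnone := @step_col_none m n T j z
  have hodd := @step_col_odd m n T j z
  generalize colPos T j z = t at hlt habove hti hmin hnone hodd
  -- The landing row `t` is at most the row `i` of `w`, so these entries lie north-west of `w`,
  -- which is smaller than `z`.
  have hleft : ∀ c a, c < j → T t c = some a → RowLT a (Sum.inrₗ z) := fun c a hc ha => by
    obtain ⟨j₀, rfl⟩ := Nat.exists_eq_succ_of_ne_zero (Nat.ne_zero_of_lt hc)
    obtain ⟨w, hw, hwz, -⟩ := hw j₀ rfl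
    exact Or.inl ((hT.le_of_le (hti (by omega)) (by omega) ha hw).trans_lt hwz.lt_odd)
  have hbig : ∀ k c a, t ≤ k → j ≤ c → T k c = some a → Sum.inrₗ z < a :=
    fun k c a hk hc ha => by
      obtain ⟨e, he⟩ := hT.exists_of_mem (μ.up_left_mem hk hc (hT.mem ha))
      exact (hlt e he).trans_le (hT.le_of_le hk hc he ha)
  have hput : ∀ A', (∀ c, c ∈ A' ↔ c = (t, j) ∨ c ∈ μ) → Tab (T.put t j (Sum.inrₗ z)) A' :=
    fun A' hA' => hT.put hA' hleft (fun c a hc ha => Or.inl (hbig t c a le_rfl hc.le ha))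
      (fun k a hk ha => by
        obtain ⟨e, he, hez⟩ := habove k hk
        obtain rfl := Option.some.inj (he.symm.trans ha)
        exact colLT_odd hez)
      (fun k a hk ha => Or.inl (hbig k j a hk.le le_rfl ha)) fun x hx => absurd hx.symm even_ne_odd
  rcases he : T t j with _ | e
  · have hm : (t, j) ∉ μ := hT.not_mem he
    obtain ⟨μ', hμ'⟩ := μ.exists_addBox hm
      (fun k hk => by
        obtain ⟨e, he, -⟩ := habove k hk
        exact hT.mem he)
      (fun c hc => by
        obtain ⟨j₀, rfl⟩ := Nat.exists_eq_succ_of_ne_zero (Nat.ne_zero_of_lt hc)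
        obtain ⟨w, hw, -⟩ := hw j₀ rfl
        exact μ.up_left_mem (hti (by omega)) (by omega) (hT.mem hw))
    refine ⟨T.put t j (Sum.inrₗ z), μ', t, j, fun _ => t, fun _ => z,
      reaches_head (hnone he) .refl, hμ', hput _ hμ'.2, le_rfl, ⟨fun c hc hc' => ?_, by omega⟩, rfl,
      rfl, hti, fun k c x => ?_, fun k c hc => put_of_ne _ _ (by simp; omega),
      fun L q₀ y₀ hch hL hz => ?_⟩
    · obtain rfl := le_antisymm hc hc'
      exact put_self _ _ _ _
    · by_cases hkc : (k, c) = (t, j)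
      · obtain ⟨rfl, rfl⟩ := Prod.mk.inj hkc
        rw [put_self, he]
        simp
      · rw [put_of_ne _ _ hkc]
    -- The chain's letter in column `j` exceeds `z`, so it lies in row `t` or below; then box `(t,
    -- j)` could not be vacant.
    · have hq := hch.1 j le_rfl hL
      exact absurd (μ.up_left_mem (hmin _ _ hq hz) le_rfl (hT.mem hq)) hm
  · obtain ⟨z', rfl, hzz⟩ := exists_odd_of_odd_lt (hlt e he)
    have hj : j < μ.rowLen 0 :=
      YoungDiagram.mem_iff_lt_rowLen.1 (μ.up_left_mem (Nat.zero_le t) le_rfl (hT.mem he))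
    have hT₁ := hput {c | c ∈ μ} fun c =>
      ⟨Or.inr, fun h => h.elim (fun h => h ▸ hT.mem he) id⟩
    obtain ⟨T', μ', R, L', q, y, hreach, hμ', hT', hL', hch, hy, hq, hqi, hev, hlow, hguard⟩ :=
      ih (d - 1) (by omega) (T.put t j (Sum.inrₗ z)) t (j + 1) z' hT₁ (by omega) (by
        rintro j₀ hj₀
        obtain rfl : j = j₀ := by omega
        refine ⟨_, put_self _ _ _ _, Or.inl (odd_lt_odd.2 hzz), fun e he' => ?_⟩
        rw [put_of_ne _ _ (by simp)] at he'
        exact (hT.row _ _ _ _ _ (Nat.lt_succ_self j) he he').odd_lt)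
    refine ⟨T', μ', R, L', fun c => if c = j then t else q c, fun c => if c = j then z else y c,
      reaches_head (hodd he) hreach, hμ', hT', by omega,
      ⟨fun c hc hc' => ?_, fun c hc hc' => ?_⟩, if_pos rfl, by simp only; rw [if_neg (by omega), hq],
      fun hj => by simpa using hti hj, fun k c x => ?_, fun k c hc => ?_,
      fun L q₀ y₀ hch₀ hL hz => ?_⟩
    · rcases hc.eq_or_lt with rfl | hc
      · simp only [if_true]
        rw [hlow _ _ (Nat.lt_succ_self _), put_self]
      · simp only [if_neg hc.ne']
        exact hch.1 c hc hc'
    · rcases hc.eq_or_lt with rfl | hc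
      · simp only [if_true, if_neg (Nat.succ_ne_self _)]
        exact ⟨hqi (Nat.succ_ne_zero _), hy ▸ hzz⟩
      · simp only [if_neg hc.ne', if_neg (show c + 1 ≠ j by omega)]
        exact hch.2 c hc hc'
    · rw [hev]
      by_cases hkc : (k, c) = (t, j)
      · obtain ⟨rfl, rfl⟩ := Prod.mk.inj hkc
        rw [put_self, he]
        simp only [Option.some.injEq]
        exact ⟨fun h => absurd h.symm even_ne_odd, fun h => absurd h.symm even_ne_odd⟩
      · rw [put_of_ne _ _ hkc]
    · rw [hlow _ _ (by omega), put_of_ne _ _ (by simp; omega)]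
    · rcases hL.eq_or_lt with rfl | hL
      · omega
      · refine hguard L q₀ y₀ ⟨fun c hc hc' => ?_, fun c hc hc' => hch₀.2 c (by omega) hc'⟩ hL ?_
        · rw [put_of_ne _ _ (by simp; omega)]
          exact hch₀.1 c (by omega) hc'
        -- The displaced `z'` is the topmost entry larger than `z`, hence at most `y₀ j` and smaller
        -- than `y₀ (j + 1)`: the hypothesis passes to the next column.
        · have hq := hch₀.1 j le_rfl hL.le
          have := odd_le_odd.1 (hT.le_of_le (hmin _ _ hq hz) le_rfl he hq)
          exact this.trans_lt (hch₀.2 j le_rfl hL).2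

end Filling

/-! ### Slides of the empty box -/

namespace Filling

variable {m n : ℕ}

theorem erase_eq_some {T : Filling m n} {i j k l : ℕ} {a : Letter m n} :
    T.erase i j k l = some a ↔ (k, l) ≠ (i, j) ∧ T k l = some a := by
  by_cases h : (k, l) = (i, j)
  · obtain ⟨rfl, rfl⟩ := Prod.mk.inj h
    simp [erase_self]
  · simp [erase_of_ne _ h, h]

theorem put_erase_comm (T : Filling m n) {i j k l : ℕ} (a : Letter m n) (h : (i, j) ≠ (k, l)) :
    (T.put i j a).erase k l = (T.erase k l).put i j a := by
  funext r c
  by_cases h1 : (r, c) = (i, j)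
  · obtain ⟨rfl, rfl⟩ := Prod.mk.inj h1
    rw [erase_of_ne _ h, put_self, put_self]
  · rw [put_of_ne _ _ h1]
    by_cases h2 : (r, c) = (k, l)
    · obtain ⟨rfl, rfl⟩ := Prod.mk.inj h2
      rw [erase_self, erase_self]
    · rw [erase_of_ne _ h2, erase_of_ne _ h2, put_of_ne _ _ h1]

theorem put_erase_of_ne (T : Filling m n) {i j k l r c : ℕ} (a : Letter m n)
    (h : (r, c) ≠ (i, j)) (h' : (r, c) ≠ (k, l)) : (T.put i j a).erase k l r c = T r c := by
  rw [erase_of_ne _ h', put_of_ne _ _ h]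

theorem put_erase_self (T : Filling m n) {i j k l : ℕ} (a : Letter m n)
    (h : (i, j) ≠ (k, l)) : (T.put i j a).erase k l i j = some a := by
  rw [erase_of_ne _ h, put_self]

section Slide

variable {T : Filling m n} {μ : YoungDiagram} {i j : ℕ} {a b : Letter m n}

theorem Tab.exists_of_ne_hole (h : Tab T ({c | c ∈ μ} \ {(i, j)})) {k l : ℕ} (hm : (k, l) ∈ μ)
    (hne : (k, l) ≠ (i, j)) : ∃ a, T k l = some a :=
  h.exists_of_mem ⟨hm, hne⟩

theorem move_shape {A : Set (ℕ × ℕ)} {c d : ℕ × ℕ} (hc : c ∈ A) (hcd : c ≠ d) (e : ℕ × ℕ) :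
    e ∈ A \ {d} ↔ e = c ∨ e ∈ (A \ {c}) \ {d} := by
  by_cases h : e = c
  · subst h
    simp [hc, hcd]
  · simp [h]

/-- Entries above the empty box are compared with `a` through column `j + 1`. Those below are
compared through the box directly under the empty one, where the slide rule gives the relation. -/
theorem Tab.slide_right (h : Tab T ({c | c ∈ μ} \ {(i, j)})) (hm : (i, j) ∈ μ)
    (ha : T i (j + 1) = some a) (hb : ∀ b, T (i + 1) j = some b → ColLT a b) :
    Tab ((T.put i j a).erase i (j + 1)) ({c | c ∈ μ} \ {(i, j + 1)}) := by
  rw [put_erase_comm _ _ (by simp)]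
  refine (h.erase i (j + 1)).put (move_shape hm (by simp)) (fun c e hc he => ?_)
    (fun c e hc he => ?_) (fun k e hk he => ?_) (fun k e hk he => ?_) fun x hx => ?_
  · exact h.row _ _ _ _ _ (by omega) (erase_eq_some.1 he).2 ha
  · obtain ⟨hne, he⟩ := erase_eq_some.1 he
    have : c ≠ j + 1 := fun h => hne (by rw [h])
    exact h.row _ _ _ _ _ (by omega) ha he
  · obtain ⟨hne, he⟩ := erase_eq_some.1 he
    obtain ⟨f, hf⟩ := h.exists_of_ne_hole (μ.up_left_mem hk.le le_rfl (h.mem ha).1)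
      (by simp)
    exact Or.inl ((h.row _ _ _ _ _ (Nat.lt_succ_self j) he hf).lt_of_colLT
      (h.col _ _ _ _ _ hk hf ha))
  · obtain ⟨hne, he⟩ := erase_eq_some.1 he
    rcases (Nat.succ_le_of_lt hk).eq_or_lt with rfl | hk'
    · exact hb _ he
    · obtain ⟨f, hf⟩ := h.exists_of_ne_hole (μ.up_left_mem hk'.le le_rfl (h.mem he).1)
        (by simp)
      exact (hb f hf).trans (h.col _ _ _ _ _ hk' hf he)
  · exact h.symplectic _ _ _ (hx ▸ ha)

theorem Tab.slide_down (h : Tab T ({c | c ∈ μ} \ {(i, j)})) (hm : (i, j) ∈ μ)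
    (hb : T (i + 1) j = some b) (ha : ∀ a, T i (j + 1) = some a → ¬ColLT a b) :
    Tab ((T.put i j b).erase (i + 1) j) ({c | c ∈ μ} \ {(i + 1, j)}) := by
  rw [put_erase_comm _ _ (by simp)]
  refine (h.erase (i + 1) j).put (move_shape hm (by simp)) (fun c e hc he => ?_)
    (fun c e hc he => ?_) (fun k e hk he => ?_) (fun k e hk he => ?_) fun x hx => ?_
  · obtain ⟨hne, he⟩ := erase_eq_some.1 he
    obtain ⟨f, hf⟩ := h.exists_of_ne_hole (μ.up_left_mem le_rfl hc.le (h.mem hb).1)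
      (by simp)
    exact Or.inl ((h.col _ _ _ _ _ (Nat.lt_succ_self i) he hf).lt_of_rowLT
      (h.row _ _ _ _ _ hc hf hb))
  · obtain ⟨hne, he⟩ := erase_eq_some.1 he
    rcases (Nat.succ_le_of_lt hc).eq_or_lt with rfl | hc'
    · exact rowLT_of_not_colLT (ha _ he)
    · obtain ⟨f, hf⟩ := h.exists_of_ne_hole (μ.up_left_mem le_rfl hc'.le (h.mem he).1)
        (by simp)
      exact (rowLT_of_not_colLT (ha f hf)).trans (h.row _ _ _ _ _ hc' hf he)
  · exact h.col _ _ _ _ _ (by omega) (erase_eq_some.1 he).2 hb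
  · obtain ⟨hne, he⟩ := erase_eq_some.1 he
    have : k ≠ i + 1 := fun h => hne (by rw [h])
    exact h.col _ _ _ _ _ (by omega) hb he
  · exact (Nat.le_succ i).trans (h.symplectic _ _ _ (hx ▸ hb))

theorem ColChain.antitone {s L : ℕ} {q : ℕ → ℕ} {y : ℕ → B1 n} (h : ColChain T s L q y) {c d : ℕ}
    (hc : s ≤ c) (hcd : c ≤ d) (hd : d ≤ L) : q d ≤ q c := by
  induction d, hcd using Nat.le_induction with
  | base => exact le_rfl
  | succ d hcd ih => exact (h.2 d (by omega) (by omega)).1.trans (ih (by omega))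

/-- The sliding letter `a` is never on the chain. If it were, the chain's letter in column `j` would
lie below the empty box and be smaller than `a`, so the entry just below the empty box would be
smaller than `a` and would slide instead. -/
theorem ColChain.slide_right (h : Tab T ({c | c ∈ μ} \ {(i, j)}))
    (ha : T i (j + 1) = some a) (hb : ∀ b, T (i + 1) j = some b → ColLT a b) {L : ℕ} {q : ℕ → ℕ}
    {y : ℕ → B1 n} (hch : ColChain T 0 L q y) :
    ColChain ((T.put i j a).erase i (j + 1)) 0 L q y := by
  have hij : T i j = none := h.eq_none (by simp)
  refine ⟨fun c hc hc' => ?_, hch.2⟩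
  have hqc := hch.1 c hc hc'
  rw [put_erase_of_ne, hqc]
  · intro h'
    obtain ⟨h1, rfl⟩ := Prod.mk.inj h'
    rw [h1, hij] at hqc
    cases hqc
  · intro h'
    obtain ⟨h1, rfl⟩ := Prod.mk.inj h'
    have hqj := hch.1 j (Nat.zero_le _) (by omega)
    obtain ⟨hq, hy⟩ := hch.2 j (Nat.zero_le _) (by omega)
    have hne : q j ≠ i := fun h2 => by
      rw [h2, hij] at hqj
      cases hqj
    obtain ⟨b, hb'⟩ := h.exists_of_ne_hole
      (μ.up_left_mem (show i + 1 ≤ q j by omega) le_rfl (h.mem hqj).1) (by simp)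
    have hby : b ≤ Sum.inrₗ (y j) := by
      rcases (show i + 1 ≤ q j by omega).eq_or_lt with h2 | h2
      · rw [← h2, hb'] at hqj
        exact (Option.some.inj hqj).le
      · exact ColLT.le (h.col _ _ _ _ _ h2 hb' hqj)
    rw [h1, ha] at hqc
    obtain rfl := Option.some.inj hqc
    exact ((ColLT.le (hb b hb')).trans hby).not_gt (odd_lt_odd.2 hy)

/-- If the chain loses its letter in row `i + 1`, its part from column `j` on is lifted to row `i`
wherever it was lower. The entries there are letters of `B₁`, since the right neighbour of the empty
box exceeds the letter that slid up. -/
theorem ColChain.slide_down (h : Tab T ({c | c ∈ μ} \ {(i, j)})) (hm : (i, j) ∈ μ)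
    (hb : T (i + 1) j = some b) (ha : ∀ a, T i (j + 1) = some a → ¬ColLT a b) {L : ℕ} {q : ℕ → ℕ}
    {y : ℕ → B1 n} (hch : ColChain T 0 L q y) :
    ∃ q' y', ColChain ((T.put i j b).erase (i + 1) j) 0 L q' y' ∧ q' L ≤ q L := by
  have hij : T i j = none := h.eq_none (by simp)
  have hne : ∀ c ≤ L, (q c, c) ≠ (i, j) := fun c hc h' => by
    obtain ⟨h1, rfl⟩ := Prod.mk.inj h'
    have := hch.1 c (Nat.zero_le _) hc
    rw [h1, hij] at this
    cases this
  by_cases hj : j ≤ L ∧ q j = i + 1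
  swap
  · refine ⟨q, y, ⟨fun c hc hc' => ?_, hch.2⟩, le_rfl⟩
    rw [put_erase_of_ne _ _ (hne c hc'), hch.1 c hc hc']
    intro h'
    obtain ⟨h1, rfl⟩ := Prod.mk.inj h'
    exact hj ⟨hc', h1⟩
  obtain ⟨hjL, hqj⟩ := hj
  obtain rfl : b = Sum.inrₗ (y j) := by
    have := hch.1 j (Nat.zero_le _) hjL
    rw [hqj, hb] at this
    exact Option.some.inj this
  have hT' := h.slide_down hm hb ha
  have key : ∀ c, ∃ z, c ≤ L →
      (T.put i j (Sum.inrₗ (y j))).erase (i + 1) j (if j ≤ c then min (q c) i else q c) c =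
        some (Sum.inrₗ z) ∧ z ≤ y c ∧ (c ≤ j ∨ q c ≤ i → z = y c) := by
    intro c
    by_cases hcL : c ≤ L
    swap
    · exact ⟨y c, fun h => absurd h hcL⟩
    have hqc := hch.1 c (Nat.zero_le _) hcL
    rcases lt_trichotomy c j with hc | rfl | hc
    · refine ⟨y c, fun _ => ⟨?_, le_rfl, fun _ => rfl⟩⟩
      rw [if_neg (by omega), put_erase_of_ne _ _ (by simp; omega) (by simp; omega), hqc]
    · refine ⟨y c, fun _ => ⟨?_, le_rfl, fun _ => rfl⟩⟩
      rw [if_pos le_rfl, min_eq_right (by omega), put_erase_self _ _ (by simp)]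
    · have hle := hch.antitone (Nat.zero_le j) hc.le hcL
      rw [if_pos hc.le, put_erase_of_ne _ _ (by simp; omega) (by simp; omega)]
      by_cases hqi : q c ≤ i
      · rw [min_eq_left hqi]
        exact ⟨y c, fun _ => ⟨hqc, le_rfl, fun _ => rfl⟩⟩
      · rw [min_eq_right (by omega)]
        have hm' : (i, c) ∈ μ := μ.up_left_mem (by omega) le_rfl (h.mem hqc).1
        obtain ⟨e, he⟩ := h.exists_of_ne_hole hm' (by simp; omega)
        obtain ⟨f, hf⟩ := h.exists_of_ne_hole
          (μ.up_left_mem le_rfl (show j + 1 ≤ c by omega) hm') (by simp)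
        have hfe : f ≤ e := by
          rcases (show j + 1 ≤ c by omega).eq_or_lt with rfl | h2
          · exact (Option.some.inj (hf.symm.trans he)).le
          · exact (h.row _ _ _ _ _ h2 hf he).le
        obtain ⟨z, rfl, -⟩ :=
          exists_odd_of_odd_lt ((rowLT_of_not_colLT (ha f hf)).odd_lt.trans_le hfe)
        refine ⟨z, fun _ => ⟨he, ?_, fun h' => by omega⟩⟩
        exact odd_le_odd.1 (ColLT.le (h.col _ _ _ _ _ (by omega) he hqc))
  choose y' hy' using key
  refine ⟨fun c => if j ≤ c then min (q c) i else q c, y',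
    ⟨fun c _ hc => (hy' c hc).1, fun c _ hc => ?_⟩, ?_⟩
  · have hq' : (if j ≤ c + 1 then min (q (c + 1)) i else q (c + 1)) ≤
        if j ≤ c then min (q c) i else q c := by
      have := (hch.2 c (Nat.zero_le _) hc).1
      split_ifs <;> omega
    refine ⟨hq', ?_⟩
    obtain ⟨h1, h2, -⟩ := hy' c hc.le
    obtain ⟨h3, -, h4⟩ := hy' (c + 1) hc
    -- Within one row the new chain increases because rows of the new tableau do; where it rises,
    -- its right-hand letter is an unchanged letter of the old chain.
    rcases hq'.eq_or_lt with h5 | h5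
    · rw [h5] at h3
      exact odd_lt_odd.1 (hT'.row _ _ _ _ _ (Nat.lt_succ_self c) h1 h3).lt_odd
    · have h6 : c + 1 ≤ j ∨ q (c + 1) ≤ i := by
        by_contra h6
        rw [if_pos (by omega), if_pos (by omega)] at h5
        omega
      rw [h4 h6]
      exact h2.trans_lt (hch.2 c (Nat.zero_le _) hc).2
  · simp only [if_pos hjL]
    exact min_le_left _ _

end Slide

/-- What a slide that started in row `i` and ended in row `R` leaves behind in the rows from `i`
on, `h r` being the column in which it left row `r`. -/
def Trail (T : Filling m n) (i R : ℕ) (h : ℕ → ℕ) : Prop :=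
  ∀ r, i ≤ r →
    (r < R → h r ≤ h (r + 1) ∧ ∃ b, T r (h r) = some b ∧
      (∀ w : B0 m, b = Sum.inlₗ w → r + 1 ≤ (ofLex w).1.val) ∧
      ∀ c < h r, ∃ e, T (r + 1) c = some e ∧ RowLT e b) ∧
    (r = R → ∀ c, h r ≤ c → T r c = none)

/-- In its first row a trail says nothing about boxes to the left of `h`; these are the ones that a
second slide disturbs. -/
theorem Trail.congr {T T' : Filling m n} {i i' R : ℕ} {h : ℕ → ℕ} (ht : Trail T i R h)
    (hi : i ≤ i') (heq : ∀ r c, i' ≤ r → (r = i' → h r ≤ c) → T' r c = T r c) :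
    Trail T' i' R h := by
  intro r hr
  obtain ⟨h1, h2⟩ := ht r (hi.trans hr)
  refine ⟨fun hrR => ?_, fun hrR c hc => ?_⟩
  · obtain ⟨h3, b, hb, hw, hlt⟩ := h1 hrR
    refine ⟨h3, b, by rw [heq _ _ hr fun _ => le_rfl, hb], hw, fun c hc => ?_⟩
    rw [heq _ _ (by omega) fun h => by omega]
    exact hlt c hc
  · rw [heq _ _ hr fun _ => hc]
    exact h2 hrR c hc

/-- The slides that move the empty box from `(i, j)` to an outer corner. -/
theorem exists_reaches_hole {μ : YoungDiagram} (N : ℕ) :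
    ∀ (T : Filling m n) (i j : ℕ), Tab T ({c | c ∈ μ} \ {(i, j)}) → (i, j) ∈ μ →
    (∀ k l, (k, l) ∈ μ → k + l < i + j + N) →
    ∃ (T' : Filling m n) (μ' : YoungDiagram) (R C : ℕ),
      Reaches step (.hole T i j) (.cancelled T') ∧ μ'.AddBox (R, C) μ ∧ Tab T' {c | c ∈ μ'} ∧
      i ≤ R ∧ (∃ h, Trail T' i R h ∧ j ≤ h i) ∧
      (∀ k c, k < i ∨ c < j → T' k c = T k c) ∧
      (∀ R₀ h, Trail T i R₀ h → j < h i → R₀ ≤ R) ∧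
      ∀ L q y, ColChain T 0 L q y → ∃ q' y', ColChain T' 0 L q' y' ∧ q' L ≤ q L := by
  induction N with
  | zero => exact fun T i j _ hm hN => absurd (hN i j hm) (by omega)
  | succ N ih =>
    intro T i j hT hm hN
    have hij : T i j = none := hT.eq_none (by simp)
    by_cases hright : ∃ a, T i (j + 1) = some a ∧ ∀ b, T (i + 1) j = some b → ColLT a b
    · obtain ⟨a, ha, hb⟩ := hright
      obtain ⟨T', μ', R, C, hreach, hμ', hT', hR, ⟨h, ht, hh⟩, hsame, htrail, hchain⟩ :=
        ih _ i (j + 1) (hT.slide_right hm ha hb) (hT.mem ha).1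
          (fun k l hkl => by have := hN k l hkl; omega)
      refine ⟨T', μ', R, C, reaches_head (step_hole_right ha hb) hreach, hμ', hT', hR,
        ⟨h, ht, by omega⟩, fun k c hkc => ?_, fun R₀ h₀ ht₀ hj => ?_, fun L q y hch =>
          hchain L q y (hch.slide_right hT ha hb)⟩
      · rw [hsame k c (by omega), put_erase_of_ne _ _ (by simp; omega) (by simp; omega)]
      · by_cases hR₀ : R₀ < i
        · omega
        -- The empty box cannot step onto the trail: the letter there was raised by the earlier
        -- slide and is not `ColLT` the entry below the empty box, so the latter would slide up.
        have hj' : j + 1 < h₀ i := by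
          refine lt_of_le_of_ne hj fun heq => ?_
          obtain ⟨h1, h2⟩ := ht₀ i le_rfl
          rcases (not_lt.1 hR₀).eq_or_lt with rfl | hlt
          · rw [h2 rfl _ heq.ge] at ha
            cases ha
          · obtain ⟨-, b, hb', -, h3⟩ := h1 hlt
            obtain ⟨e, he, hlt⟩ := h3 j hj
            rw [← heq, ha] at hb'
            obtain rfl := Option.some.inj hb'
            exact hlt.not_colLT (hb e he)
        refine htrail R₀ h₀ (ht₀.congr le_rfl fun r c hr hc => ?_) hj'
        have hne : ∀ c', c' < h₀ i → (r, c) ≠ (i, c') := fun c' hc' h' => by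
          obtain ⟨rfl, rfl⟩ := Prod.mk.inj h'
          exact (hc rfl).not_gt hc'
        exact put_erase_of_ne _ _ (hne _ hj) (hne _ hj')
    · push Not at hright
      rcases hb : T (i + 1) j with _ | b
      · have ha : T i (j + 1) = none := by
          rcases ha : T i (j + 1) with _ | a
          · rfl
          · obtain ⟨b, hb', -⟩ := hright a ha
            rw [hb] at hb'
            cases hb'
        have hm1 : (i + 1, j) ∉ μ := fun h => hT.not_mem hb ⟨h, by simp⟩
        have hm2 : (i, j + 1) ∉ μ := fun h => hT.not_mem ha ⟨h, by simp⟩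
        obtain ⟨μ', hμ'⟩ := μ.exists_removeBox hm hm1 hm2
        refine ⟨T, μ', i, j, reaches_head (step_hole_none ha hb) .refl, hμ', ?_, le_rfl,
          ⟨fun _ => j, fun r hr => ⟨fun hr' => by omega, ?_⟩, le_rfl⟩, fun _ _ _ => rfl,
          fun R₀ h₀ ht₀ hj => ?_, fun L q y hch => ⟨q, y, hch, le_rfl⟩⟩
        · convert hT using 1
          ext c
          have := hμ'.2 c
          simp only [Set.mem_ofPred_eq, Set.mem_sdiff, Set.mem_singleton_iff, this]
          by_cases hc : c = (i, j)
          · subst hc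
            simpa using hμ'.1
          · simp [hc]
        · rintro rfl c hc
          refine hT.eq_none fun h => ?_
          rcases hc.eq_or_lt with rfl | hc
          · exact h.2 rfl
          · exact hm2 (μ.up_left_mem le_rfl hc h.1)
        · by_contra hlt
          obtain ⟨-, b, -, -, h3⟩ := (ht₀ i le_rfl).1 (by omega)
          obtain ⟨e, he, -⟩ := h3 j hj
          rw [hb] at he
          cases he
      · have ha : ∀ a, T i (j + 1) = some a → ¬ColLT a b := fun a ha hab => by
          obtain ⟨b', hb', h'⟩ := hright a ha
          rw [hb] at hb'
          obtain rfl := Option.some.inj hb'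
          exact h' hab
        obtain ⟨T', μ', R, C, hreach, hμ', hT', hR, ⟨h, ht, hh⟩, hsame, htrail, hchain⟩ :=
          ih _ (i + 1) j (hT.slide_down hm hb ha) (hT.mem hb).1
            (fun k l hkl => by have := hN k l hkl; omega)
        refine ⟨T', μ', R, C, reaches_head (step_hole_down hb ha) hreach, hμ', hT', by omega,
          ⟨fun r => if r = i then j else h r, fun r hr => ?_, by simp⟩, fun k c hkc => ?_,
          fun R₀ h₀ ht₀ hj => ?_, fun L q y hch => ?_⟩
        · rcases hr.eq_or_lt with rfl | hr
          · simp only [if_true, if_neg (Nat.succ_ne_self i)]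
            refine ⟨fun _ => ⟨hh, b, ?_, ?_, fun c hc => ?_⟩, fun h => by omega⟩
            · rw [hsame _ _ (by omega), put_erase_self _ _ (by simp)]
            · rintro w rfl
              exact hT.symplectic _ _ _ hb
            · rw [hsame _ _ (by omega), put_erase_of_ne _ _ (by simp) (by simp; omega)]
              obtain ⟨e, he⟩ := hT.exists_of_ne_hole
                (μ.up_left_mem le_rfl hc.le (hT.mem hb).1) (by simp)
              exact ⟨e, he, hT.row _ _ _ _ _ hc he hb⟩
          · simp only [if_neg hr.ne', if_neg (show r + 1 ≠ i by omega)]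
            exact ht r hr
        · rw [hsame k c (by omega), put_erase_of_ne _ _ (by simp; omega) (by simp; omega)]
        · by_cases hR₀ : R₀ ≤ i
          · omega
          have hj' : j < h₀ (i + 1) := hj.trans_le ((ht₀ i le_rfl).1 (by omega)).1
          refine htrail R₀ h₀ (ht₀.congr (Nat.le_succ i) fun r c hr hc => ?_) hj'
          refine put_erase_of_ne _ _ (by simp; omega) ?_
          intro h'
          obtain ⟨rfl, rfl⟩ := Prod.mk.inj h'
          have := hc rfl
          omega
        · obtain ⟨q₁, y₁, h1, h2⟩ := hch.slide_down hT hm hb ha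
          obtain ⟨q₂, y₂, h3, h4⟩ := hchain L q₁ y₁ h1
          exact ⟨q₂, y₂, h3, h4.trans h2⟩

end Filling

/-! ### Row insertion and the marks that it leaves -/

namespace Letter

variable {m n : ℕ}

theorem val_le_of_le {x x' : B0 m} (h : x ≤ x') : (ofLex x).1.val ≤ (ofLex x').1.val := by
  rcases (Prod.Lex.le_iff).1 h with h | h
  · exact Fin.le_def.1 h.le
  · exact (congrArg Fin.val h.1).le

/-- Only an unbarred letter displacing its own barred version gives `x < x'` without raising the
bound. Cancellation is thus exactly what protects the symplectic condition in the next row. -/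
theorem succ_le_val_of_not_isCancellation {i : ℕ} {x x' : B0 m} (hx : i ≤ (ofLex x).1.val)
    (hlt : x < x') (hc : ¬IsCancellation i x (Sum.inlₗ x' : Letter m n)) :
    i + 1 ≤ (ofLex x').1.val := by
  rcases (Prod.Lex.lt_iff).1 hlt with h | ⟨h, h'⟩
  · have := Fin.lt_def.1 h
    omega
  · by_contra hlt'
    have h1 : (ofLex x).1.val = (ofLex x').1.val := congrArg Fin.val h
    obtain ⟨h2, h3⟩ := Bool.lt_iff.1 h'
    refine hc ⟨(ofLex x).1, by omega, ?_, ?_⟩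
    · exact ofLex.injective (Prod.ext rfl h2)
    · exact even_inj.2 (ofLex.injective (Prod.ext h.symm h3))

end Letter

namespace Filling

variable {m n : ℕ}

/-- The rows from `i` on bear the marks of the row insertion of a letter that is at most `x`:
down to row `i₀`, or until a letter of `B₁` was displaced or a box was added. -/
inductive Guard (T : Filling m n) (s i₀ : ℕ) : ℕ → B0 m → Prop
  | passed {i : ℕ} {x : B0 m} : i₀ ≤ i → Guard T s i₀ i x
  | last {i : ℕ} {x : B0 m} (p : ℕ) (u : B0 m) : T i p = some (Sum.inlₗ u) → u ≤ x → s ≤ p + 1 →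
      (∀ c w, p < c → T i c ≠ some (Sum.inlₗ w)) → Guard T s i₀ i x
  | step {i : ℕ} {x : B0 m} (p : ℕ) (u v : B0 m) : T i p = some (Sum.inlₗ u) → u ≤ x → s ≤ p + 1 →
      i + 1 ≤ (ofLex v).1.val → (∀ c e, p < c → T i c = some e → Sum.inlₗ v ≤ e) →
      Guard T s i₀ (i + 1) v → Guard T s i₀ i x

/-- This passes the mark of one letter on to all later letters of a weakly increasing word. -/
theorem Guard.mono {T : Filling m n} {s i₀ i : ℕ} {x x' : B0 m} (h : Guard T s i₀ i x)
    (hx : x ≤ x') : Guard T s i₀ i x' := by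
  cases h with
  | passed h => exact .passed h
  | last p u h1 h2 h3 h4 => exact .last p u h1 (h2.trans hx) h3 h4
  | step p u v h1 h2 h3 h4 h5 h6 => exact .step p u v h1 (h2.trans hx) h3 h4 h5 h6

theorem Guard.congr {T T' : Filling m n} {s i₀ i : ℕ} {x : B0 m} (h : Guard T s i₀ i x)
    (heq : ∀ k c, i ≤ k → T' k c = T k c) : Guard T' s i₀ i x := by
  induction h with
  | passed h => exact .passed h
  | last p u h1 h2 h3 h4 =>
    refine .last p u (by rw [heq _ _ le_rfl, h1]) h2 h3 fun c w hc => ?_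
    rw [heq _ _ le_rfl]
    exact h4 c w hc
  | step p u v h1 h2 h3 h4 h5 h6 ih =>
    refine .step p u v (by rw [heq _ _ le_rfl, h1]) h2 h3 h4 (fun c e hc => ?_)
      (ih fun k c hk => heq k c (by omega))
    rw [heq _ _ le_rfl]
    exact h5 c e hc

/-- The situation in which `x` is to be inserted into row `i`, after being displaced from
column `b` of the row above. -/
structure RowState (T : Filling m n) (μ : YoungDiagram) (i : ℕ) (x : B0 m) (b : ℕ) : Prop where
  tab : Tab T {c | c ∈ μ}
  le_val : i ≤ (ofLex x).1.val
  above : ∀ i₀, i = i₀ + 1 → ∃ w, T i₀ b = some (Sum.inlₗ w) ∧ w < x ∧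
    ∀ e, T i b = some e → Sum.inlₗ x < e

namespace RowState

variable {T : Filling m n} {μ : YoungDiagram} {i b : ℕ} {x : B0 m}

theorem rowPos_le (h : RowState T μ i x b) (hi : i ≠ 0) : rowPos T i x ≤ b := by
  obtain ⟨i₀, rfl⟩ := Nat.exists_eq_succ_of_ne_zero hi
  obtain ⟨w, -, -, hw⟩ := h.above i₀ rfl
  exact InsState.rowPos_le hw

theorem lt_of_rowPos_le (h : RowState T μ i x b) {k c : ℕ} {a : Letter m n} (hk : i ≤ k)
    (hc : rowPos T i x ≤ c) (ha : T k c = some a) : Sum.inlₗ x < a := by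
  obtain ⟨e, he⟩ := h.tab.exists_of_mem (μ.up_left_mem hk hc (h.tab.mem ha))
  exact (rowPos_lt (h.tab.exists_row_none i) he).trans_le (h.tab.le_of_le hk hc he ha)

/-- The entries above row `i` and weakly to the left of the insertion column are smaller
than `x`. -/
theorem lt_of_above (h : RowState T μ i x b) {k c : ℕ} {a : Letter m n} (hk : k < i)
    (hc : c ≤ rowPos T i x) (ha : T k c = some a) : a < Sum.inlₗ x := by
  have hb := h.rowPos_le (Nat.ne_zero_of_lt hk)
  obtain ⟨i₀, rfl⟩ := Nat.exists_eq_succ_of_ne_zero (Nat.ne_zero_of_lt hk)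
  obtain ⟨w, hw, hwx, -⟩ := h.above i₀ rfl
  exact (h.tab.le_of_le (Nat.le_of_lt_succ hk) (hc.trans hb) ha hw).trans_lt (even_lt_even.2 hwx)

theorem put (h : RowState T μ i x b) {A : Set (ℕ × ℕ)}
    (hA : ∀ c, c ∈ A ↔ c = (i, rowPos T i x) ∨ c ∈ μ) :
    Tab (T.put i (rowPos T i x) (Sum.inlₗ x)) A := by
  refine h.tab.put hA (fun c a hc ha => ?_)
    (fun c a hc ha => Or.inl (h.lt_of_rowPos_le le_rfl hc.le ha))
    (fun k a hk ha => Or.inl (h.lt_of_above hk le_rfl ha))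
    (fun k a hk ha => Or.inl (h.lt_of_rowPos_le hk.le le_rfl ha))
    fun x' hx' => even_inj.1 hx' ▸ h.le_val
  obtain ⟨e, he, hex⟩ := exists_le_of_lt_rowPos hc
  obtain rfl := Option.some.inj (he.symm.trans ha)
  exact rowLT_even hex

theorem exists_addBox (h : RowState T μ i x b) (hn : T i (rowPos T i x) = none) :
    ∃ μ', μ.AddBox (i, rowPos T i x) μ' := by
  refine μ.exists_addBox (h.tab.not_mem hn) (fun k hk => ?_) fun c hc => ?_
  · have hb := h.rowPos_le (Nat.ne_zero_of_lt hk)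
    obtain ⟨i₀, rfl⟩ := Nat.exists_eq_succ_of_ne_zero (Nat.ne_zero_of_lt hk)
    obtain ⟨w, hw, -⟩ := h.above i₀ rfl
    exact μ.up_left_mem (Nat.le_of_lt_succ hk) hb (h.tab.mem hw)
  · obtain ⟨e, he, -⟩ := exists_le_of_lt_rowPos hc
    exact h.tab.mem he

/-- The letter lands strictly to the right of an entry that is at most as large. -/
theorem lt_rowPos (h : RowState T μ i x b) {p : ℕ} {u : B0 m} (hu : T i p = some (Sum.inlₗ u))
    (hux : u ≤ x) : p < rowPos T i x := by
  by_contra hlt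
  exact (h.lt_of_rowPos_le le_rfl (not_lt.1 hlt) hu).not_ge (even_le_even.2 hux)

theorem next (h : RowState T μ i x b) {x' : B0 m}
    (hx' : T i (rowPos T i x) = some (Sum.inlₗ x'))
    (hc : ¬IsCancellation i x (Sum.inlₗ x' : Letter m n)) :
    RowState (T.put i (rowPos T i x) (Sum.inlₗ x)) μ (i + 1) x' (rowPos T i x) where
  tab := h.put fun c => ⟨Or.inr, fun hc => hc.elim (fun hc => hc ▸ h.tab.mem hx') id⟩
  le_val := succ_le_val_of_not_isCancellation h.le_val
    (even_lt_even.1 (h.lt_of_rowPos_le le_rfl le_rfl hx')) hc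
  above i₀ hi₀ := by
    obtain rfl : i = i₀ := by omega
    refine ⟨x, put_self _ _ _ _, even_lt_even.1 (h.lt_of_rowPos_le le_rfl le_rfl hx'),
      fun e he => ?_⟩
    rw [put_of_ne _ _ (by simp)] at he
    rcases h.tab.col _ _ _ _ _ (Nat.lt_succ_self i) hx' he with h' | ⟨-, y, hy⟩
    exacts [h', absurd hy even_ne_odd]

end RowState

/-- The part of a row insertion in which letters of `B₀` displace letters of `B₀`. -/
theorem exists_reaches_row {μ : YoungDiagram} (d : ℕ) :
    ∀ (T : Filling m n) (i : ℕ) (x : B0 m) (b : ℕ), RowState T μ i x b → m ≤ i + d →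
    ∃ (T₁ : Filling m n) (r : ℕ) (x₁ : B0 m) (b₁ : ℕ),
      Reaches step (.row T i x) (.row T₁ r x₁) ∧ RowState T₁ μ r x₁ b₁ ∧ i ≤ r ∧
      (i ≠ 0 → rowPos T₁ r x₁ ≤ b) ∧
      (∀ x', T₁ r (rowPos T₁ r x₁) = some (Sum.inlₗ x') →
        IsCancellation r x₁ (Sum.inlₗ x' : Letter m n)) ∧
      (∀ k c, r ≤ k → T₁ k c = T k c) ∧
      (∀ k c, k < i → T₁ k c = T k c) ∧
      (∀ k c (y : B1 n), T₁ k c = some (Sum.inrₗ y) ↔ T k c = some (Sum.inrₗ y)) ∧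
      (∀ s i₀, Guard T s i₀ i x → i₀ ≤ r ∨ s ≤ rowPos T₁ r x₁ ∧
        ∀ e, T₁ r (rowPos T₁ r x₁) = some e → ¬IsCancellation r x₁ e) ∧
      ∀ (T' : Filling m n) (s i₀ : ℕ), (∀ k c (w : B0 m), k < r →
          (T' k c = some (Sum.inlₗ w) ↔ T₁ k c = some (Sum.inlₗ w))) →
        s ≤ rowPos T₁ r x₁ + 1 → Guard T' s i₀ r x₁ → Guard T' s i₀ i x := by
  induction d with
  | zero =>
    intro T i x b h hd
    have := h.le_val
    have := (ofLex x).1.isLt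
    omega
  | succ d ih =>
    intro T i x b h hd
    by_cases hbump : ∃ x', T i (rowPos T i x) = some (Sum.inlₗ x') ∧
      ¬IsCancellation i x (Sum.inlₗ x' : Letter m n)
    · obtain ⟨x', hx', hc⟩ := hbump
      obtain ⟨T₁, r, x₁, b₁, hreach, hstate, hir, hpos, hterm, hge, hlow, hodd, hguard, hback⟩ :=
        ih _ _ _ _ (h.next hx' hc) (by omega)
      have hpos := hpos (Nat.succ_ne_zero i)
      have hlow' : ∀ c, T₁ i c = T.put i (rowPos T i x) (Sum.inlₗ x) i c :=
        fun c => hlow i c (Nat.lt_succ_self i)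
      refine ⟨T₁, r, x₁, b₁, reaches_head (step_row_even hx' hc) hreach, hstate, by omega,
        fun hi => hpos.trans (h.rowPos_le hi), hterm, fun k c hk => ?_, fun k c hk => ?_,
        fun k c y => ?_, fun s i₀ hg => ?_, fun T' s i₀ heq hs hg => ?_⟩
      · rw [hge k c hk, put_of_ne _ _ (by simp; omega)]
      · rw [hlow k c (by omega), put_of_ne _ _ (by simp; omega)]
      · rw [hodd]
        by_cases hkc : (k, c) = (i, rowPos T i x)
        · obtain ⟨rfl, rfl⟩ := Prod.mk.inj hkc
          rw [put_self, hx']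
          simp only [Option.some.injEq]
          exact ⟨fun h => absurd h even_ne_odd, fun h => absurd h even_ne_odd⟩
        · rw [put_of_ne _ _ hkc]
      · cases hg with
        | passed h' => exact Or.inl (by omega)
        | last p u h1 h2 h3 h4 => exact absurd hx' (h4 _ _ (h.lt_rowPos h1 h2))
        | step p u v h1 h2 h3 h4 h5 h6 =>
          refine hguard s i₀ ((h6.mono (even_le_even.1 (h5 _ _ (h.lt_rowPos h1 h2) hx'))).congr
            fun k c hk => put_of_ne _ _ (by simp; omega))
      -- The mark in row `i` consists of `x` and the letter `x'` that it displaced. The bound on `s`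
      -- is inherited from the last row because the path moves weakly to the left as it descends.
      · refine .step (rowPos T i x) x x' ?_ le_rfl (by omega) (h.next hx' hc).le_val
          (fun c e hc he => ?_) (hback T' s i₀ heq hs hg)
        · rw [heq _ _ _ (by omega), hlow', put_self]
        · obtain ⟨w, rfl⟩ | ⟨y, rfl⟩ := even_or_odd e
          · rw [heq _ _ _ (by omega), hlow', put_of_ne _ _ (by simp; omega)] at he
            exact (h.tab.row _ _ _ _ _ hc hx' he).le
          · exact even_lt_odd.le
    · push Not at hbump
      refine ⟨T, i, x, b, .refl, h, le_rfl, h.rowPos_le, hbump, fun _ _ _ => rfl, fun _ _ _ => rfl,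
        fun _ _ _ => Iff.rfl, fun s i₀ hg => ?_, fun _ _ _ _ _ hg => hg⟩
      cases hg with
      | passed h' => exact Or.inl h'
      | last p u h1 h2 h3 h4 =>
        have hp := h.lt_rowPos h1 h2
        refine Or.inr ⟨by omega, fun e he => ?_⟩
        rintro ⟨z, -, -, rfl⟩
        exact h4 _ _ hp he
      | step p u v h1 h2 h3 h4 h5 h6 =>
        have hp := h.lt_rowPos h1 h2
        refine Or.inr ⟨by omega, fun e he => ?_⟩
        -- A cancelled entry would have index `i`, but entries to the right of `p` are at least `v`,
        -- whose index is at least `i + 1`.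
        rintro ⟨z, hz, -, rfl⟩
        have := val_le_of_le (even_le_even.1 (h5 _ _ hp he))
        simp only [ofLex_toLex] at this
        omega

end Filling

/-! ### One complete insertion of a letter of `B₀` -/

namespace Filling

variable {m n : ℕ}

theorem ColChain.congr {T T' : Filling m n} {s L : ℕ} {q : ℕ → ℕ} {y : ℕ → B1 n}
    (h : ColChain T s L q y) {s' : ℕ} (hs : s ≤ s')
    (heq : ∀ k c (z : B1 n), s' ≤ c → T k c = some (Sum.inrₗ z) → T' k c = some (Sum.inrₗ z)) :
    ColChain T' s' L q y :=
  ⟨fun c hc hc' => heq _ _ _ hc (h.1 c (hs.trans hc) hc'), fun c hc hc' => h.2 c (hs.trans hc) hc'⟩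

/-- The insertion of `x ∈ B₀` either adds a box or causes a cancellation. -/
theorem rowAdds_or_rowCancels {T : Filling m n} {μ : YoungDiagram} (hT : Tab T {c | c ∈ μ})
    (x : B0 m) :
    (∃ (T' : Filling m n) (μ' : YoungDiagram) (R L' : ℕ), RowAdds T x T' ∧ μ.AddBox (R, L') μ' ∧
      Tab T' {c | c ∈ μ'} ∧ (∃ s, Guard T' s m 0 x ∧ (L' < s ∨ ∃ q y, ColChain T' s L' q y)) ∧
      ∀ s L, (L < s ∨ ∃ q y, ColChain T s L q y) → (s = 0 ∨ Guard T s m 0 x) → L < L') ∨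
    ∃ (T' : Filling m n) (μ' : YoungDiagram) (R C : ℕ), RowCancels T x T' ∧ μ'.AddBox (R, C) μ ∧
      Tab T' {c | c ∈ μ'} ∧ (∃ i₀ h, Guard T' 0 i₀ 0 x ∧ Trail T' i₀ R h) ∧
      (∀ i₀ R₀ h, Guard T 0 i₀ 0 x → Trail T i₀ R₀ h → R₀ ≤ R) ∧
      (∀ s, ¬Guard T s m 0 x) ∧
      ∀ L q y, ColChain T 0 L q y → ∃ q' y', ColChain T' 0 L q' y' ∧ q' L ≤ q L := by
  obtain ⟨T₁, r, x₁, b₁, hreach, hst, -, -, hterm, hge, -, hodd, hguard, hback⟩ :=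
    exists_reaches_row m T 0 x 0 ⟨hT, Nat.zero_le _, by simp⟩ (by omega)
  have hrm : r < m := hst.le_val.trans_lt (ofLex x₁).1.isLt
  have hchain : ∀ {s L q y}, ColChain T s L q y → ColChain T₁ s L q y :=
    fun h => h.congr le_rfl fun k c z _ hz => (hodd k c z).2 hz
  have hlt : ∀ s L L', rowPos T₁ r x₁ ≤ L' → (L < s ∨ ∃ q y, ColChain T s L q y) →
      (s = 0 ∨ Guard T s m 0 x) →
      (∀ q y, ColChain T₁ (rowPos T₁ r x₁) L q y → rowPos T₁ r x₁ ≤ L →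
        r ≤ q (rowPos T₁ r x₁) → L < L') → L < L' := by
    intro s L L' hL' hch hs h
    have hsp : s ≤ rowPos T₁ r x₁ := by
      rcases hs with rfl | hs
      · exact Nat.zero_le _
      · exact (hguard s m hs).elim (fun h => absurd h hrm.not_ge) fun h => h.1
    rcases lt_or_ge L (rowPos T₁ r x₁) with hL | hL
    · omega
    · obtain ⟨q, y, hch⟩ := hch.resolve_left (by omega)
      have hch := (hchain hch).congr hsp fun _ _ _ _ h => h
      refine h q y hch hL ?_
      by_contra hlt
      exact (hst.lt_of_above (not_le.1 hlt) le_rfl (hch.1 _ le_rfl hL)).not_gt even_lt_odd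
  rcases he : T₁ r (rowPos T₁ r x₁) with _ | e
  · left
    have hm := hst.tab.not_mem he
    obtain ⟨μ', hμ'⟩ := hst.exists_addBox he
    refine ⟨_, μ', r, rowPos T₁ r x₁, mem_run_of_reaches
      (Relation.ReflTransGen.tail hreach (step_row_none he)) rfl, hμ', hst.put hμ'.2,
      ⟨rowPos T₁ r x₁ + 1, hback _ _ _ (fun k c w hk => ?_) le_rfl
        (.last _ x₁ (put_self _ _ _ _) le_rfl le_rfl fun c w hc h => ?_),
        Or.inl (Nat.lt_succ_self _)⟩, fun s L hch hs => hlt s L _ le_rfl hch hs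
          fun q y hch hL hr => ?_⟩
    · rw [put_of_ne _ _ (by simp; omega)]
    · rw [put_of_ne _ _ (by simp; omega)] at h
      exact hm (μ.up_left_mem le_rfl hc.le (hst.tab.mem h))
    · exact absurd (μ.up_left_mem hr le_rfl (hst.tab.mem (hch.1 _ le_rfl hL))) hm
  obtain ⟨x', rfl⟩ | ⟨z, rfl⟩ := even_or_odd e
  · right
    have hc := hterm x' he
    have hm := hst.tab.mem he
    obtain ⟨T', μ', R, C, hreach', hμ', hT', hR, ⟨h, ht, -⟩, hsame, htrail, hcol⟩ :=
      exists_reaches_hole (μ.rowLen 0 + μ.colLen 0) _ r (rowPos T₁ r x₁) (hst.tab.erase _ _) hm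
        (fun k l hkl => by
          have h1 := YoungDiagram.mem_iff_lt_rowLen.1 (μ.up_left_mem (Nat.zero_le k) le_rfl hkl)
          have h2 := YoungDiagram.mem_iff_lt_colLen.1 (μ.up_left_mem le_rfl (Nat.zero_le l) hkl)
          omega)
    refine ⟨T', μ', R, C, mem_run_of_reaches (hreach.trans
      (reaches_head (step_row_cancel he hc) hreach')) rfl, hμ', hT',
      ⟨r, h, hback _ _ _ (fun k c w hk => ?_) (Nat.zero_le _) (.passed le_rfl), ht⟩,
      fun i₀ R₀ h₀ hg ht₀ => ?_, fun s hg => ?_, fun L q y hch => hcol L q y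
        ((hchain hch).congr le_rfl fun k c z _ hz => erase_eq_some.2 ⟨fun h => ?_, hz⟩)⟩
    · rw [hsame k c (Or.inl hk), erase_of_ne _ (by simp; omega)]
    · have hi₀ : i₀ ≤ r := (hguard 0 i₀ hg).elim id fun h => absurd hc (h.2 _ he)
      rcases le_or_gt R₀ r with hlt | hlt
      · exact hlt.trans hR
      -- The trail's letter in row `r` came up from row `r + 1`, so its index is too large for it to
      -- be at most the cancelled entry; hence the new empty box starts to the left of the trail.
      have hp : rowPos T₁ r x₁ < h₀ r := by
        by_contra hp
        obtain ⟨-, b, hb, hw, -⟩ := (ht₀ r hi₀).1 hlt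
        rw [← hge _ _ le_rfl] at hb
        obtain ⟨w, rfl, hwx⟩ :=
          exists_even_of_le_even (hst.tab.le_of_le le_rfl (not_lt.1 hp) hb he)
        obtain ⟨v, hv, -, h2⟩ := hc
        rw [even_inj.1 h2] at hwx
        have h3 := val_le_of_le hwx
        have h4 := hw w rfl
        simp only [ofLex_toLex] at h3
        omega
      refine htrail R₀ h₀ (ht₀.congr hi₀ fun k c hk hc => ?_) hp
      rw [erase_of_ne _ ?_, hge _ _ hk]
      intro h
      obtain ⟨rfl, rfl⟩ := Prod.mk.inj h
      exact (hc rfl).not_gt hp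
    · exact (hguard s m hg).elim (fun h => absurd h hrm.not_ge) fun h => h.2 _ he hc
    · obtain ⟨rfl, rfl⟩ := Prod.mk.inj h
      exact even_ne_odd (Option.some.inj (he.symm.trans hz))
  · left
    have hput := hst.put (A := {c | c ∈ μ}) fun c =>
      ⟨Or.inr, fun hc => hc.elim (fun hc => hc ▸ hst.tab.mem he) id⟩
    obtain ⟨T', μ', R, L', q, y, hreach', hμ', hT', hL', hch, -, -, -, hev, -, hcol⟩ :=
      exists_reaches_col (μ.rowLen 0) _ r (rowPos T₁ r x₁ + 1) z hput (by omega) (by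
        rintro j₀ hj₀
        obtain rfl : rowPos T₁ r x₁ = j₀ := by omega
        refine ⟨_, put_self _ _ _ _, Or.inl even_lt_odd, fun e he' => ?_⟩
        rw [put_of_ne _ _ (by simp)] at he'
        exact (hst.tab.row _ _ _ _ _ (Nat.lt_succ_self _) he he').odd_lt)
    refine ⟨T', μ', R, L', mem_run_of_reaches (hreach.trans
      (reaches_head (step_row_odd he) hreach')) rfl, hμ', hT',
      ⟨rowPos T₁ r x₁ + 1, hback _ _ _ (fun k c w hk => ?_) le_rfl
        (.last (rowPos T₁ r x₁) x₁ ?_ le_rfl le_rfl fun c w hc h => ?_), Or.inr ⟨q, y, hch⟩⟩,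
      fun s L hch hs => hlt s L _ (by omega) hch hs fun q y hch hL hr => ?_⟩
    · rw [hev, put_of_ne _ _ (by simp; omega)]
    · rw [hev, put_self]
    · rw [hev, put_of_ne _ _ (by simp; omega)] at h
      exact (hst.tab.row _ _ _ _ _ hc he h).odd_lt.not_gt even_lt_odd
    · rcases hL.eq_or_lt with hL | hL
      · omega
      · refine hcol L q y (hch.congr (Nat.le_succ _) fun k c z hc hz => ?_) hL
          ((odd_le_odd.1 (hst.tab.le_of_le hr le_rfl he (hch.1 _ le_rfl hL.le))).trans_lt
            (hch.2 _ le_rfl hL).2)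
        rwa [put_of_ne _ _ (by simp; omega)]

end Filling

/-! ### Building horizontal strips box by box -/

theorem mem_skewCells {lam mu : YoungDiagram} {c : ℕ × ℕ} :
    c ∈ skewCells lam mu ↔ c ∈ lam ∧ c ∉ mu := by
  simp [skewCells]

theorem isHorizontalStrip_self (mu : YoungDiagram) :
    IsHorizontalStrip mu mu ∧ (skewCells mu mu).card = 0 := by
  have h : skewCells mu mu = ∅ := Finset.sdiff_self _
  refine ⟨⟨le_rfl, fun b hb => ?_⟩, by rw [h, Finset.card_empty]⟩
  rw [h] at hb
  exact absurd hb (Finset.notMem_empty b)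

namespace YoungDiagram

variable {μ μ₁ ν : YoungDiagram} {c : ℕ × ℕ}

theorem AddBox.le (h : μ.AddBox c μ₁) : μ ≤ μ₁ := fun d hd => (h.2 d).2 (Or.inr hd)

theorem AddBox.skewCells_eq_insert_left (h : μ.AddBox c μ₁) (hν : μ₁ ≤ ν) :
    skewCells ν μ = insert c (skewCells ν μ₁) := by
  ext d
  rw [Finset.mem_insert, mem_skewCells, mem_skewCells, h.2]
  by_cases hd : d = c
  · subst hd
    simpa [h.1] using hν ((h.2 d).2 (Or.inl rfl))
  · simp [hd]

theorem AddBox.skewCells_eq_insert_right (h : μ₁.AddBox c μ) (hν : ν ≤ μ₁) :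
    skewCells μ ν = insert c (skewCells μ₁ ν) := by
  ext d
  rw [Finset.mem_insert, mem_skewCells, mem_skewCells, h.2]
  by_cases hd : d = c
  · subst hd
    simpa using fun h' => h.1 (hν h')
  · simp [hd]

theorem strip_of_insert {α β : YoungDiagram} {S : Finset (ℕ × ℕ)} (hle : α ≤ β)
    (hS : skewCells β α = insert c S) (hstrip : ∀ b ∈ S, ∀ d ∈ S, b.2 = d.2 → b = d)
    (hc : ∀ d ∈ S, c.2 ≠ d.2) :
    IsHorizontalStrip β α ∧ (skewCells β α).card = S.card + 1 := by
  refine ⟨⟨hle, fun b hb d hd hbd => ?_⟩, ?_⟩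
  · rw [hS, Finset.mem_insert] at hb hd
    rcases hb with rfl | hb <;> rcases hd with rfl | hd
    · rfl
    · exact absurd hbd (hc d hd)
    · exact absurd hbd.symm (hc b hb)
    · exact hstrip b hb d hd hbd
  · rw [hS, Finset.card_insert_of_notMem fun h => hc c h rfl]

theorem AddBox.strip_left (h : μ.AddBox c μ₁) (hν : IsHorizontalStrip ν μ₁)
    (hc : ∀ d ∈ skewCells ν μ₁, c.2 ≠ d.2) :
    IsHorizontalStrip ν μ ∧ (skewCells ν μ).card = (skewCells ν μ₁).card + 1 :=
  strip_of_insert (h.le.trans hν.1) (h.skewCells_eq_insert_left hν.1) hν.2 hc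

theorem AddBox.strip_right (h : μ₁.AddBox c μ) (hν : IsHorizontalStrip μ₁ ν)
    (hc : ∀ d ∈ skewCells μ₁ ν, c.2 ≠ d.2) :
    IsHorizontalStrip μ ν ∧ (skewCells μ ν).card = (skewCells μ₁ ν).card + 1 :=
  strip_of_insert (hν.1.trans h.le) (h.skewCells_eq_insert_right hν.1) hν.2 hc

end YoungDiagram

/-! ### Insertion of monotone words -/

namespace Filling

variable {m n : ℕ}

/-- The insertion of a decreasing sequence of letters of `B₁`. -/
theorem exists_chain_colAdds (w : List (B1 n)) :
    ∀ (T : Filling m n) (lam : YoungDiagram), Tab T {c | c ∈ lam} → w.Pairwise (· > ·) →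
    ∃ (T₀ : Filling m n) (mu : YoungDiagram), Chain ColAdds T w T₀ ∧ Tab T₀ {c | c ∈ mu} ∧
      IsHorizontalStrip mu lam ∧ (skewCells mu lam).card = w.length ∧
      (∀ L q y, ColChain T 0 L q y → (∀ z ∈ w, z < y 0) → ∀ c ∈ skewCells mu lam, L < c.2) ∧
      (w ≠ [] → ∃ L q y, ColChain T₀ 0 L q y ∧ (q L, L) ∈ skewCells mu lam ∧
        ∀ c ∈ skewCells mu lam, c.2 ≤ L) := by
  induction w with
  | nil =>
    intro T lam hT _
    have h := isHorizontalStrip_self lam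
    refine ⟨T, lam, rfl, hT, h.1, h.2, fun L q y _ _ c hc => ?_, fun h => absurd rfl h⟩
    rw [Finset.card_eq_zero.1 h.2] at hc
    exact absurd hc (Finset.notMem_empty c)
  | cons z w ih =>
    intro T lam hT hw
    obtain ⟨hz, hw⟩ := List.pairwise_cons.1 hw
    obtain ⟨S, lam₁, R, L₁, q₁, y₁, hreach, hlam, hS, -, hch, hy, hq, -, -, -, hguard⟩ :=
      exists_reaches_col (lam.rowLen 0) T 0 0 z hT (by omega) (by omega)
    obtain ⟨T₀, mu, hchain, hT₀, hstrip, hcard, hright, hlast⟩ := ih S lam₁ hS hw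
    have hL₁ : ∀ c ∈ skewCells mu lam₁, L₁ < c.2 :=
      hright L₁ q₁ y₁ hch fun z' hz' => hy ▸ hz z' hz'
    have heq := hlam.skewCells_eq_insert_left hstrip.1
    obtain ⟨h1, h2⟩ := hlam.strip_left hstrip fun d hd => (hL₁ d hd).ne
    refine ⟨T₀, mu, ⟨S, mem_run_of_reaches hreach rfl, hchain⟩, hT₀, h1, by rw [h2, hcard]; rfl,
      fun L q y hch hzy c hc => ?_, fun _ => ?_⟩
    · have hL := hguard L q y hch (Nat.zero_le _) (hzy z (by simp))
      rw [heq, Finset.mem_insert] at hc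
      rcases hc with rfl | hc
      · exact hL
      · exact hL.trans (hL₁ c hc)
    · rw [heq]
      by_cases hne : w = []
      · subst hne
        obtain rfl : S = T₀ := hchain
        refine ⟨L₁, q₁, y₁, hch, by rw [hq]; exact Finset.mem_insert_self _ _, fun c hc => ?_⟩
        rw [Finset.card_eq_zero.1 hcard] at hc
        obtain rfl : c = (R, L₁) := by simpa using hc
        exact le_rfl
      · obtain ⟨L, q, y, h3, h4, h5⟩ := hlast hne
        refine ⟨L, q, y, h3, Finset.mem_insert_of_mem h4, fun c hc => ?_⟩
        rcases Finset.mem_insert.1 hc with rfl | hc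
        · exact (hL₁ _ h4).le
        · exact h5 c hc

/-- The insertion of an increasing sequence of letters of `B₀` after a first box was added. -/
theorem exists_chain_rowAdds (w : List (B0 m)) :
    ∀ (T : Filling m n) (mu : YoungDiagram) (s L : ℕ), Tab T {c | c ∈ mu} → w.Pairwise (· ≤ ·) →
    (L < s ∨ ∃ q y, ColChain T s L q y) → (∀ x ∈ w, Guard T s m 0 x) →
    ∃ (T₂ : Filling m n) (nu : YoungDiagram), Chain RowAdds T w T₂ ∧ Tab T₂ {c | c ∈ nu} ∧
      IsHorizontalStrip nu mu ∧ (skewCells nu mu).card = w.length ∧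
      ∀ c ∈ skewCells nu mu, L < c.2 := by
  induction w with
  | nil =>
    intro T mu s L hT _ _ _
    have h := isHorizontalStrip_self mu
    refine ⟨T, mu, rfl, hT, h.1, h.2, fun c hc => ?_⟩
    rw [Finset.card_eq_zero.1 h.2] at hc
    exact absurd hc (Finset.notMem_empty c)
  | cons x w ih =>
    intro T mu s L hT hw hch hg
    obtain ⟨hx, hw⟩ := List.pairwise_cons.1 hw
    have hgx := hg x (by simp)
    obtain ⟨S, mu₁, R, L₁, hadd, hmu, hS, ⟨s₁, hg₁, hch₁⟩, hlt⟩ |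
      ⟨_, _, _, _, _, _, _, _, _, hno, _⟩ := rowAdds_or_rowCancels hT x
    swap
    · exact absurd hgx (hno s)
    obtain ⟨T₂, nu, hchain, hT₂, hstrip, hcard, hright⟩ :=
      ih S mu₁ s₁ L₁ hS hw hch₁ fun x' hx' => hg₁.mono (hx x' hx')
    obtain ⟨h1, h2⟩ := hmu.strip_left hstrip fun d hd => (hright d hd).ne
    have hL := hlt s L hch (Or.inr hgx)
    refine ⟨T₂, nu, ⟨S, hadd, hchain⟩, hT₂, h1, by rw [h2, hcard]; rfl, fun c hc => ?_⟩
    rw [hmu.skewCells_eq_insert_left hstrip.1, Finset.mem_insert] at hc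
    rcases hc with rfl | hc
    · exact hL
    · exact hL.trans (hright c hc)

/-- The insertion of an increasing sequence of letters of `B₀`: first cancellations, then
additions. -/
theorem exists_chain_rowCancels_rowAdds (w : List (B0 m)) :
    ∀ (T : Filling m n) (mu : YoungDiagram), Tab T {c | c ∈ mu} → w.Pairwise (· ≤ ·) →
    ∃ (ell : ℕ) (T₁ T₂ : Filling m n) (mu₁ nu : YoungDiagram), ell ≤ w.length ∧
      Chain RowCancels T (w.take ell) T₁ ∧ Chain RowAdds T₁ (w.drop ell) T₂ ∧
      Tab T₁ {c | c ∈ mu₁} ∧ Tab T₂ {c | c ∈ nu} ∧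
      IsHorizontalStrip mu mu₁ ∧ IsHorizontalStrip nu mu₁ ∧
      (skewCells mu mu₁).card = ell ∧ (skewCells nu mu₁).card = w.length - ell ∧
      (∀ i₀ R h, (∀ x ∈ w, Guard T 0 i₀ 0 x) → Trail T i₀ R h →
        ∀ c ∈ skewCells mu mu₁, R ≤ c.1) ∧
      ∀ L q y, ColChain T 0 L q y → (∃ q' y', ColChain T₁ 0 L q' y' ∧ q' L ≤ q L) ∧
        ∀ c ∈ skewCells nu mu₁, L < c.2 := by
  induction w with
  | nil =>
    intro T mu hT _
    have h := isHorizontalStrip_self mu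
    refine ⟨0, T, T, mu, mu, le_rfl, rfl, rfl, hT, hT, h.1, h.1, h.2, h.2, fun _ _ _ _ _ c hc => ?_,
      fun L q y hch => ⟨⟨q, y, hch, le_rfl⟩, fun c hc => ?_⟩⟩ <;>
    · rw [Finset.card_eq_zero.1 h.2] at hc
      exact absurd hc (Finset.notMem_empty c)
  | cons x w ih =>
    intro T mu hT hw
    obtain ⟨hx, hw⟩ := List.pairwise_cons.1 hw
    obtain ⟨S, mu₁, R, L₁, hadd, hmu, hS, ⟨s₁, hg₁, hch₁⟩, hlt⟩ |
      ⟨S, mu', R, C, hcan, hmu, hS, ⟨i₁, h₁, hg₁, ht₁⟩, htrail, -, hcol⟩ :=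
      rowAdds_or_rowCancels hT x
    · obtain ⟨T₂, nu, hchain, hT₂, hstrip, hcard, hright⟩ :=
        exists_chain_rowAdds w S mu₁ s₁ L₁ hS hw hch₁ fun x' hx' => hg₁.mono (hx x' hx')
      obtain ⟨h1, h2⟩ := hmu.strip_left hstrip fun d hd => (hright d hd).ne
      have h := isHorizontalStrip_self mu
      refine ⟨0, T, T₂, mu, nu, Nat.zero_le _, rfl, ⟨S, hadd, hchain⟩, hT, hT₂, h.1, h1, h.2,
        by rw [h2, hcard]; rfl, fun _ _ _ _ _ c hc => ?_,
        fun L q y hch => ⟨⟨q, y, hch, le_rfl⟩, fun c hc => ?_⟩⟩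
      · rw [Finset.card_eq_zero.1 h.2] at hc
        exact absurd hc (Finset.notMem_empty c)
      · have hL := hlt 0 L (Or.inr ⟨q, y, hch⟩) (Or.inl rfl)
        rw [hmu.skewCells_eq_insert_left hstrip.1, Finset.mem_insert] at hc
        rcases hc with rfl | hc
        · exact hL
        · exact hL.trans (hright c hc)
    · obtain ⟨ell, T₁, T₂, mu₁, nu, hell, hc1, hc2, hT₁, hT₂, hs1, hs2, hn1, hn2, hrow, hchain⟩ :=
        ih S mu' hS hw
      have hR := hrow i₁ R h₁ (fun x' hx' => hg₁.mono (hx x' hx')) ht₁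
      -- Boxes removed later lie in row `R` or below; one in column `C` or beyond would force the
      -- removed corner `(R, C)` back into `mu'`.
      have hC : ∀ d ∈ skewCells mu' mu₁, d.2 < C := fun d hd => by
        by_contra hlt
        exact hmu.1 (mu'.up_left_mem (hR d hd) (not_lt.1 hlt) (mem_skewCells.1 hd).1)
      obtain ⟨h1, h2⟩ := hmu.strip_right hs1 fun d hd => (hC d hd).ne'
      refine ⟨ell + 1, T₁, T₂, mu₁, nu, Nat.succ_le_succ hell, ⟨S, hcan, hc1⟩, hc2, hT₁, hT₂, h1,
        hs2, by rw [h2, hn1], by rw [hn2, List.length_cons]; omega,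
        fun i₀ R₀ h₀ hg₀ ht₀ c hc => ?_, fun L q y hch => ?_⟩
      · have hR₀ := htrail i₀ R₀ h₀ (hg₀ x (by simp)) ht₀
        rw [hmu.skewCells_eq_insert_right hs1.1, Finset.mem_insert] at hc
        rcases hc with rfl | hc
        · exact hR₀
        · exact hR₀.trans (hR c hc)
      · obtain ⟨q₁, y₁, h3, h4⟩ := hcol L q y hch
        obtain ⟨⟨q₂, y₂, h5, h6⟩, h7⟩ := hchain L q₁ y₁ h3
        exact ⟨⟨q₂, y₂, h5, h6.trans h4⟩, h7⟩

theorem mem_foldlM_of_chain {α : Type} {R : Filling m n → α → Filling m n → Prop}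
    {f : Filling m n → α → Part (Filling m n)} (hf : ∀ T x S, R T x S → S ∈ f T x) (w : List α) :
    ∀ {T T' : Filling m n}, Chain R T w T' → T' ∈ w.foldlM f T := by
  induction w with
  | nil => exact fun h => Part.mem_some_iff.2 (Eq.symm h)
  | cons x w ih =>
    rintro T T' ⟨S, h, h'⟩
    rw [List.foldlM_cons]
    exact Part.mem_bind (hf T x S h) (ih h')

theorem mem_rowInsert_of_rowAdds {T T' : Filling m n} {x : B0 m} (h : RowAdds T x T') :
    T' ∈ rowInsert T x :=
  Part.mem_map InsState.filling h

theorem mem_rowInsert_of_rowCancels {T T' : Filling m n} {x : B0 m} (h : RowCancels T x T') :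
    T' ∈ rowInsert T x :=
  Part.mem_map InsState.filling h

theorem mem_colInsert_of_colAdds {T T' : Filling m n} {y : B1 n} (h : ColAdds T y T') :
    T' ∈ colInsert T y :=
  Part.mem_map InsState.filling h

end Filling

/-! ### Reading the one-row tableau -/

theorem mem_rowDiagram {k i j : ℕ} : (i, j) ∈ rowDiagram k ↔ i = 0 ∧ j < k := by
  simp only [rowDiagram, YoungDiagram.mem_ofRowLens]
  constructor
  · rintro ⟨h, h'⟩
    obtain rfl : i = 0 := by simpa using h
    exact ⟨rfl, by simpa using h'⟩
  · rintro ⟨rfl, h⟩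
    exact ⟨by simp, by simpa using h⟩

theorem getLeft?_eq_some {m n : ℕ} {e : Letter m n} {x : B0 m} :
    (ofLex e).getLeft? = some x ↔ e = Sum.inlₗ x := by
  rw [Sum.getLeft?_eq_some_iff]
  exact ⟨fun h => ofLex.injective h, fun h => h ▸ rfl⟩

theorem getRight?_eq_some {m n : ℕ} {e : Letter m n} {y : B1 n} :
    (ofLex e).getRight? = some y ↔ e = Sum.inrₗ y := by
  rw [Sum.getRight?_eq_some_iff]
  exact ⟨fun h => ofLex.injective h, fun h => h ▸ rfl⟩

namespace Filling

variable {m n k : ℕ} {U : Filling m n}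

theorem length_add_length_filterMap (w : List (Letter m n)) :
    (w.filterMap fun e => (ofLex e).getLeft?).length +
      (w.filterMap fun e => (ofLex e).getRight?).length = w.length := by
  induction w with
  | nil => rfl
  | cons e w ih =>
    obtain ⟨x, rfl⟩ | ⟨y, rfl⟩ := even_or_odd e
    · rw [List.filterMap_cons_some (f := fun e : Letter m n => (ofLex e).getLeft?)
        (getLeft?_eq_some.2 rfl), List.filterMap_cons_none rfl,
        List.length_cons, List.length_cons, ← ih]
      omega
    · rw [List.filterMap_cons_some (f := fun e : Letter m n => (ofLex e).getRight?)
        (getRight?_eq_some.2 rfl), List.filterMap_cons_none rfl,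
        List.length_cons, List.length_cons, ← ih]
      omega

theorem length_even_add_length_odd (hU : Tab U {c | c ∈ rowDiagram k}) :
    (evenLetters U k).length + (oddLetters U k).length = k := by
  rw [evenLetters, oddLetters, length_add_length_filterMap, rowWord]
  have : ∀ l : List ℕ, (∀ j ∈ l, j < k) → (l.filterMap (U 0)).length = l.length := by
    intro l
    induction l with
    | nil => exact fun _ => rfl
    | cons j l ih =>
      intro h
      obtain ⟨e, he⟩ := hU.exists_of_mem (mem_rowDiagram.2 ⟨rfl, h j (by simp)⟩)
      rw [List.filterMap_cons_some he, List.length_cons, List.length_cons,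
        ih fun j hj => h j (by simp [hj])]
  rw [this _ fun j hj => List.mem_range.1 hj, List.length_range]

theorem pairwise_rowWord (hU : Tab U {c | c ∈ rowDiagram k}) : (rowWord U k).Pairwise RowLT :=
  List.pairwise_filterMap.2 (List.pairwise_lt_range.imp fun hjj a ha b hb =>
    hU.row 0 _ _ a b hjj ha hb)

theorem pairwise_evenLetters (hU : Tab U {c | c ∈ rowDiagram k}) :
    (evenLetters U k).Pairwise (· ≤ ·) :=
  List.pairwise_filterMap.2 ((pairwise_rowWord hU).imp fun hab x hx x' hx' => by
    rw [getLeft?_eq_some.1 hx, getLeft?_eq_some.1 hx'] at hab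
    exact even_le_even.1 hab.le)

theorem pairwise_oddLetters (hU : Tab U {c | c ∈ rowDiagram k}) :
    (oddLetters U k).Pairwise (· < ·) :=
  List.pairwise_filterMap.2 ((pairwise_rowWord hU).imp fun hab y hy y' hy' => by
    rw [getRight?_eq_some.1 hy, getRight?_eq_some.1 hy'] at hab
    exact odd_lt_odd.1 hab.lt_odd)

end Filling

/-! ### Assembly of the three stages -/

theorem mainTheorem3 (m n k : ℕ) (T U : Filling m n) (lam : YoungDiagram)
    (hT : IsSpoTableau T lam) (hU : IsSpoTableau U (rowDiagram k)) :
    -- `T₀`, `T₁`, `T₂` are the tableaux after the three stages, of shapes `mu₀`, `mu₁`, `nu`;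
    -- `ell` letters of `B₀` are cancelled, `m₂` are added
    ∃ (T₀ T₁ T₂ : Filling m n) (mu₀ mu₁ nu : YoungDiagram) (ell m₂ : ℕ),
      ell + m₂ = (Filling.evenLetters U k).length ∧
      -- the three stages
      T₀ ∈ Filling.colInsertWord (Filling.oddLetters U k) T ∧
      Filling.Chain Filling.ColAdds T (Filling.oddLetters U k).reverse T₀ ∧
      T₁ ∈ Filling.rowInsertWord T₀ ((Filling.evenLetters U k).take ell) ∧
      Filling.Chain Filling.RowCancels T₀ ((Filling.evenLetters U k).take ell) T₁ ∧
      T₂ ∈ Filling.rowInsertWord T₁ ((Filling.evenLetters U k).drop ell) ∧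
      Filling.Chain Filling.RowAdds T₁ ((Filling.evenLetters U k).drop ell) T₂ ∧
      -- the result is the product, and all stages are tableaux of the stated shapes
      T₂ ∈ Filling.mulRow T U k ∧
      IsSpoTableau T₀ mu₀ ∧ IsSpoTableau T₁ mu₁ ∧ IsSpoTableau T₂ nu ∧
      -- the properties of the sequence of shapes
      IsHorizontalStrip mu₀ lam ∧ IsHorizontalStrip mu₀ mu₁ ∧ IsHorizontalStrip nu mu₁ ∧
      (Filling.oddLetters U k).length ≤ k ∧
      (skewCells mu₀ lam).card = (Filling.oddLetters U k).length ∧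
      ell ≤ k - (Filling.oddLetters U k).length ∧
      (skewCells mu₀ mu₁).card = ell ∧
      (lam.rowLen 0 ≠ mu₀.rowLen 0 → mu₀.rowLen 0 = mu₁.rowLen 0) ∧
      (skewCells nu mu₁).card = k - (Filling.oddLetters U k).length - ell ∧
      (∀ b ∈ skewCells nu mu₁, ∀ c ∈ skewCells mu₀ lam, c.2 < b.2) := by
  rw [isSpoTableau_iff] at hT hU
  have hlen := length_even_add_length_odd hU
  obtain ⟨T₀, mu₀, hc0, hT₀, hs0, hn0, -, hlast⟩ :=
    exists_chain_colAdds (oddLetters U k).reverse T lam hT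
      (List.pairwise_reverse.2 (pairwise_oddLetters hU))
  obtain ⟨ell, T₁, T₂, mu₁, nu, hell, hc1, hc2, hT₁, hT₂, hs1, hs2, hn1, hn2, -, hchain⟩ :=
    exists_chain_rowCancels_rowAdds (evenLetters U k) T₀ mu₀ hT₀ (pairwise_evenLetters hU)
  have hm0 : T₀ ∈ colInsertWord (oddLetters U k) T :=
    mem_foldlM_of_chain (f := colInsert) (fun _ _ _ => mem_colInsert_of_colAdds) _ hc0
  have hm1 : T₁ ∈ rowInsertWord T₀ ((evenLetters U k).take ell) :=
    mem_foldlM_of_chain (f := rowInsert) (fun _ _ _ => mem_rowInsert_of_rowCancels) _ hc1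
  have hm2 : T₂ ∈ rowInsertWord T₁ ((evenLetters U k).drop ell) :=
    mem_foldlM_of_chain (f := rowInsert) (fun _ _ _ => mem_rowInsert_of_rowAdds) _ hc2
  rw [List.length_reverse] at hn0
  have hlast' : ∀ c ∈ skewCells mu₀ lam, ∃ L q y, ColChain T₀ 0 L q y ∧
      (q L, L) ∈ skewCells mu₀ lam ∧ ∀ c ∈ skewCells mu₀ lam, c.2 ≤ L := fun c hc =>
    hlast fun h => by
      rw [List.reverse_eq_nil_iff.1 h] at hn0
      exact (Finset.card_pos.2 ⟨c, hc⟩).ne' hn0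
  refine ⟨T₀, T₁, T₂, mu₀, mu₁, nu, ell, (evenLetters U k).length - ell, by omega, hm0, hc0, hm1,
    hc1, hm2, hc2, Part.mem_bind hm0 ?_, isSpoTableau_iff.2 hT₀, isSpoTableau_iff.2 hT₁,
    isSpoTableau_iff.2 hT₂, hs0, hs1, hs2, by omega, hn0, by omega, hn1, fun hne => ?_, by omega,
    fun b hb c hc => ?_⟩
  · rw [← List.take_append_drop ell (evenLetters U k), rowInsertWord, List.foldlM_append]
    exact Part.mem_bind hm1 hm2
  · have hmem : ∀ c, (0, c) ∈ skewCells mu₀ lam ↔ c < mu₀.rowLen 0 ∧ lam.rowLen 0 ≤ c := by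
      intro c
      rw [mem_skewCells, YoungDiagram.mem_iff_lt_rowLen, YoungDiagram.mem_iff_lt_rowLen, not_lt]
    have hmono : ∀ {α β : YoungDiagram}, α ≤ β → α.rowLen 0 ≤ β.rowLen 0 := by
      intro α β h
      by_contra hlt
      exact (YoungDiagram.mem_iff_lt_rowLen.1
        (h (YoungDiagram.mem_iff_lt_rowLen.2 (not_le.1 hlt)))).false
    have hlam := hmono hs0.1
    have hC : (0, lam.rowLen 0) ∈ skewCells mu₀ lam := (hmem _).2 ⟨by omega, le_rfl⟩
    obtain ⟨L, q, y, hch, hbox, hle⟩ := hlast' _ hC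
    have hCL := hle _ hC
    have h0L : (0, L) ∈ skewCells mu₀ lam := (hmem L).2
      ⟨YoungDiagram.mem_iff_lt_rowLen.1
        (mu₀.up_left_mem (Nat.zero_le _) le_rfl (mem_skewCells.1 hbox).1), hCL⟩
    -- The strip has one box in column `L`, so the chain ends in the first row. Cancellations can
    -- only raise its end, so box `(0, L)` stays filled.
    have hq : q L = 0 := (Prod.mk.inj (hs0.2 _ hbox _ h0L rfl)).1
    obtain ⟨⟨q', y', hch', hq'⟩, -⟩ := hchain L q y hch
    have h1 := hch'.1 L (Nat.zero_le _) le_rfl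
    rw [show q' L = 0 by omega] at h1
    have h2 := YoungDiagram.mem_iff_lt_rowLen.1 (hT₁.mem h1)
    have h3 := hmono hs1.1
    -- By maximality of `L` the first row of `mu₀` ends in column `L`, so it cannot have lost a box.
    have h4 : ¬L + 1 < mu₀.rowLen 0 := fun h => by
      have := hle _ ((hmem (L + 1)).2 ⟨h, by omega⟩)
      simp only at this
      omega
    omega
  · obtain ⟨L, q, y, hch, -, hle⟩ := hlast' c hc
    exact (hle c hc).trans_lt ((hchain L q y hch).2 b hb)
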